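/- Let $p\colon\mathcal E\to\mathcal B$ be a Grothendieck fibration. A map $f$ of $\mathcal E$ is \emph{vertical} if $p(f)$ is an identity. Let $V(\mathcal E)$ be the category of vertical maps and commutative squares in $\mathcal E$ (the horizontal maps of a square need not be vertical), and let $\operatorname{dom},\operatorname{cod}\colon V(\mathcal E)\to\mathcal E$ be the two projections. Assume that $\operatorname{cod}$ is a fibration, i.e. that vertical maps have pullbacks along arbitrary maps of $\mathcal E$ and these can be chosen vertical (this holds for instance if $p$ has fibred finite limits). For $Y\in\mathcal E$ let $V(\mathcal E)_Y$ be the fibre of $\operatorname{cod}$ over $Y$: its objects are the vertical maps into $Y$, its morphisms are the maps over $Y$; equivalently, it is the slice over $Y$ of the fibre category $\mathcal E_{p(Y)}$. A \emph{functorial factorisation} over $\mathcal B$ factors every vertical $f\colon X\to Y$, functorially in $f\in V(\mathcal E)$, as a vertical map $Lf\colon X\to Kf$ followed by a vertical map $Rf\colon Kf\to Y$. Then $L$ is a copointed endofunctor of $V(\mathcal E)$ over $\operatorname{dom}$ with counit $(1,Rf)\colon Lf\to f$, and $R$ is a pointed endofunctor over $\operatorname{cod}$ with unit $(Lf,1)\colon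 f\to Rf$. A \emph{lawfs} is a functorial factorisation with a comultiplication $\Sigma\colon L\Rightarrow L^2$, with identity components on domains, making $L$ a comonad. An \emph{awfs} is a lawfs with, in addition, a multiplication $\Pi\colon R^2\Rightarrow R$, with identity components on codomains, making $R$ a monad, such that the canonical transformation $LR\Rightarrow RL$ with components $(\Sigma_f,\Pi_f)$ is a distributive law of the comonad $L$ over the monad $R$. A \emph{morphism of lawfs's} $(L,R,\Sigma)\to(L',R',\Sigma')$ is a natural family of maps $\xi_f\colon Kf\to K'f$ with $\xi_f\circ Lf=L'f$ and $R'f\circ\xi_f=Rf$ that respects the comultiplications; it induces a functor from algebras over the pointed endofunctor $R'$ to algebras over the pointed endofunctor $R$. An awfs $(L',R',\Sigma',\Pi')$ is \emph{algebraically free} on a lawfs $(L,R,\Sigma)$ if there is a morphism of lawfs's $(L,R,\Sigma)\to(L',R',\Sigma')$ such that the composite functor $$(R',\Pi')\text{-}\mathrm{Alg}\to R'\text{-}\mathrm{Alg}\to R\text{-}\mathrm{Alg}$$ from algebras over the monad to algebras over the pointed endofunctor $R$ is an isomorphism of categories. \textbf{(1)} Let $(L_1,R_1)$ be a lawfs over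 $p$ and let $U\colon R_1\text{-}\mathrm{Alg}\to V(\mathcal E)$ be the forgetful functor from the algebras over the pointed endofunctor $R_1$. For $Y\in\mathcal E$ let $U_Y\colon (R_1\text{-}\mathrm{Alg})_Y\to V(\mathcal E)_Y$ be its restriction to the fibres over $Y$ of $\operatorname{cod}\circ U$ and $\operatorname{cod}$. Suppose that for every $Y\in\mathcal E$ and every vertical map $f\colon X\to Y$ the comma category $(f\downarrow U_Y)$ has an initial object. Then there exists an awfs algebraically free on $(L_1,R_1)$. \textbf{(2)} Suppose moreover that $p$ is a locally small bifibration, that $\mathcal B$ has finite limits, that $\operatorname{dom}\colon V(\mathcal E)\to\mathcal E$ is an opfibration (as holds if the fibre categories of $p$ have pushouts), and that every $V(\mathcal E)_Y$ has binary coproducts. Here $p$ is \emph{locally small} if for all $X,Z$ in a fibre $\mathcal E_I$ the functor $(\mathcal B/I)^{\mathrm{op}}\to\mathbf{Set}$, $(u\colon J\to I)\mapsto\mathcal E_J(u^*X,u^*Z)$, is representable. Let $m$ be a vertical map and let $(L_1,R_1)$ be \emph{step-one} for $m$, the following lawfs: for a vertical map $f\colon X\to Y$, take the universal family of lifting problems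 from $m$ to $f$, i.e. the universal span $m\leftarrow z\to f$ in $V(\mathcal E)$ whose left leg is cartesian over $\mathcal B$, and factor $z\to f$ as a $\operatorname{dom}$-opcartesian map $z\to L_1f$ followed by a map $L_1f\to f$ that is the identity on $X$; the latter is the counit at $f$, its codomain component is $R_1f$, and the comultiplication $L_1f\to L_1L_1f$ is the map with identity domain component induced by the span $m\leftarrow z\to L_1f$. Suppose that for every $Y\in\mathcal E$ and every vertical $f\colon X\to Y$ the endofunctor $$g\longmapsto\langle f,R_1g\rangle\colon X\sqcup K_1g\to Y$$ of $V(\mathcal E)_Y$ (the coproduct of $f$ and $R_1g$ in $V(\mathcal E)_Y$), pointed at $g\colon Z\to Y$ by the composite $Z\xrightarrow{L_1g}K_1g\hookrightarrow X\sqcup K_1g$, has an initial algebra (an initial object in the category of algebras for the pointed endofunctor). Then the awfs cofibrantly generated by $m$ exists, i.e. there is an awfs algebraically free on the step-one lawfs $(L_1,R_1)$. -/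

import Mathlib

open CategoryTheory CategoryTheory.Limits

universe v₁ v₂ u₁ u₂

namespace FibredAwfs

noncomputable section

variable {B : Type u₁} [Category.{v₁} B] {E : Type u₂} [Category.{v₂} E]

/-! ### Vertical maps -/

/-- A morphism of `E` is vertical if `p` sends it to an identity morphism. -/
def IsVertical (p : E ⥤ B) {X Y : E} (f : X ⟶ Y) : Prop :=
  p.IsHomLift (𝟙 (p.obj X)) f

/-- An object of `V(E)`: a vertical map `left ⟶ right` of `E`. -/
structure VertArrow (p : E ⥤ B) where
  left : E
  right : E
  hom : left ⟶ right
  vertical : IsVertical p hom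

namespace VertArrow

variable {p : E ⥤ B}

/-- A morphism of `V(E)`: a commutative square in `E`, whose horizontal maps need not be
vertical. -/
@[ext]
structure Hom (f g : VertArrow p) where
  left : f.left ⟶ g.left
  right : f.right ⟶ g.right
  w : left ≫ g.hom = f.hom ≫ right

/-- `V(E)`, the full subcategory of the arrow category of `E` on the vertical maps. -/
instance : Category (VertArrow p) where
  Hom := Hom
  id f := ⟨𝟙 _, 𝟙 _, by simp⟩
  comp a b := ⟨a.left ≫ b.left, a.right ≫ b.right, by
    rw [Category.assoc, b.w, ← Category.assoc, a.w, Category.assoc]⟩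
  id_comp a := Hom.ext (Category.id_comp _) (Category.id_comp _)
  comp_id a := Hom.ext (Category.comp_id _) (Category.comp_id _)
  assoc a b c := Hom.ext (Category.assoc _ _ _) (Category.assoc _ _ _)

@[ext]
theorem hom_ext {f g : VertArrow p} {a b : f ⟶ g} (h₁ : a.left = b.left)
    (h₂ : a.right = b.right) : a = b :=
  Hom.ext h₁ h₂

@[simp] theorem id_left (f : VertArrow p) : Hom.left (𝟙 f) = 𝟙 f.left := rfl
@[simp] theorem id_right (f : VertArrow p) : Hom.right (𝟙 f) = 𝟙 f.right := rfl
@[simp] theorem comp_left {f g h : VertArrow p} (a : f ⟶ g) (b : g ⟶ h) :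
    (a ≫ b).left = a.left ≫ b.left := rfl
@[simp] theorem comp_right {f g h : VertArrow p} (a : f ⟶ g) (b : g ⟶ h) :
    (a ≫ b).right = a.right ≫ b.right := rfl

end VertArrow

/-- The domain functor `V(E) ⥤ E`. -/
@[simps]
abbrev dom (p : E ⥤ B) : VertArrow p ⥤ E where
  obj f := f.left
  map a := a.left

/-- The codomain functor `V(E) ⥤ E`. -/
@[simps]
abbrev cod (p : E ⥤ B) : VertArrow p ⥤ E where
  obj f := f.right
  map a := a.right

/-- The projection `p ∘ dom` of `V(E)` to `B`. -/
abbrev base (p : E ⥤ B) : VertArrow p ⥤ B := dom p ⋙ p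

/-! ### Pointed endofunctors, their algebras, and restriction to fibres -/

/-- An algebra over the pointed endofunctor `(T, η)`. -/
structure PointedAlgebra {C : Type*} [Category* C] (T : C ⥤ C) (η : 𝟭 C ⟶ T) where
  carrier : C
  str : T.obj carrier ⟶ carrier
  unit : η.app carrier ≫ str = 𝟙 carrier

namespace PointedAlgebra

variable {C : Type*} [Category* C] {T : C ⥤ C} {η : 𝟭 C ⟶ T}

/-- A morphism of algebras over a pointed endofunctor. -/
@[ext]
structure Hom (X Y : PointedAlgebra T η) where
  hom : X.carrier ⟶ Y.carrier
  comm : T.map hom ≫ Y.str = X.str ≫ hom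

instance : Category (PointedAlgebra T η) where
  Hom := Hom
  id X := ⟨𝟙 _, by simp⟩
  comp a b := ⟨a.hom ≫ b.hom, by
    rw [T.map_comp, Category.assoc, b.comm, ← Category.assoc, a.comm, Category.assoc]⟩
  id_comp a := Hom.ext (Category.id_comp _)
  comp_id a := Hom.ext (Category.comp_id _)
  assoc a b c := Hom.ext (Category.assoc _ _ _)

@[ext]
theorem hom_ext {X Y : PointedAlgebra T η} {a b : X ⟶ Y} (h : a.hom = b.hom) : a = b :=
  Hom.ext h

@[simp] theorem id_hom (X : PointedAlgebra T η) : Hom.hom (𝟙 X) = 𝟙 X.carrier := rfl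
@[simp] theorem comp_hom {X Y Z : PointedAlgebra T η} (a : X ⟶ Y) (b : Y ⟶ Z) :
    (a ≫ b).hom = a.hom ≫ b.hom := rfl

/-- The forgetful functor from algebras over a pointed endofunctor. -/
@[simps]
def forget (T : C ⥤ C) (η : 𝟭 C ⟶ T) : PointedAlgebra T η ⥤ C where
  obj X := X.carrier
  map a := a.hom

end PointedAlgebra

/-- The restriction of a functor `F` with `q ∘ F = q'` to the fibres over `Y`. -/
@[simps]
def restrictFiber {C : Type*} [Category* C] {D : Type*} [Category* D] {S : Type*} [Category* S]
    (F : C ⥤ D) (q' : C ⥤ S) (q : D ⥤ S) (h : F ⋙ q = q') (Y : S) :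
    q'.Fiber Y ⥤ q.Fiber Y where
  obj X := ⟨F.obj X.1, (Functor.congr_obj h X.1).trans X.2⟩
  map a := ⟨F.map a.1, by
    subst h
    have ha := a.2
    exact IsHomLift.of_commSq q _ _ _ _ (IsHomLift.commSq (F ⋙ q) (𝟙 Y) a.1)⟩
  map_id X := Subtype.ext (F.map_id _)
  map_comp a b := Subtype.ext (F.map_comp _ _)

/-! ### Functorial factorisations -/

/-- A functorial factorisation over `B`: every vertical `f : X ⟶ Y` is factored, functorially in
`V(E)`, as a vertical map `l f : X ⟶ K f` followed by a vertical map `r f : K f ⟶ Y`. -/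
structure FunctorialFactorisation (p : E ⥤ B) where
  K : VertArrow p ⥤ E
  l : dom p ⟶ K
  r : K ⟶ cod p
  vertical_l : ∀ f, IsVertical p (l.app f)
  vertical_r : ∀ f, IsVertical p (r.app f)
  fac : ∀ f, l.app f ≫ r.app f = f.hom

namespace FunctorialFactorisation

variable {p : E ⥤ B} (W : FunctorialFactorisation p)

/-- The endofunctor `L` of `V(E)`, with `L f : X ⟶ K f`. -/
@[simps]
abbrev L : VertArrow p ⥤ VertArrow p where
  obj f := ⟨f.left, W.K.obj f, W.l.app f, W.vertical_l f⟩
  map a := ⟨a.left, W.K.map a, W.l.naturality a⟩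
  map_id f := VertArrow.hom_ext rfl (W.K.map_id f)
  map_comp a b := VertArrow.hom_ext rfl (W.K.map_comp a b)

/-- The endofunctor `R` of `V(E)`, with `R f : K f ⟶ Y`. -/
@[simps]
abbrev R : VertArrow p ⥤ VertArrow p where
  obj f := ⟨W.K.obj f, f.right, W.r.app f, W.vertical_r f⟩
  map a := ⟨W.K.map a, a.right, W.r.naturality a⟩
  map_id f := VertArrow.hom_ext (W.K.map_id f) rfl
  map_comp a b := VertArrow.hom_ext (W.K.map_comp a b) rfl

/-- The counit `L f ⟶ f` of the copointed endofunctor `L`: the square `(1, R f)`. -/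
@[simps]
def counit : W.L ⟶ 𝟭 (VertArrow p) where
  app f := ⟨𝟙 _, W.r.app f, (Category.id_comp _).trans (W.fac f).symm⟩
  naturality _ _ a := VertArrow.hom_ext ((Category.comp_id _).trans (Category.id_comp _).symm) (W.r.naturality a)

/-- The unit `f ⟶ R f` of the pointed endofunctor `R`: the square `(L f, 1)`. -/
@[simps]
def point : 𝟭 (VertArrow p) ⟶ W.R where
  app f := ⟨W.l.app f, 𝟙 _, (W.fac f).trans (Category.comp_id _).symm⟩
  naturality _ _ a := VertArrow.hom_ext (W.l.naturality a)
    ((Category.comp_id _).trans (Category.id_comp _).symm)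

/-- Algebras over the pointed endofunctor `R`. -/
abbrev RAlg : Type _ := PointedAlgebra W.R W.point

/-- The forgetful functor `U` from `R`-algebras to `V(E)`. -/
abbrev U : W.RAlg ⥤ VertArrow p := PointedAlgebra.forget W.R W.point

/-- The functor `U_Y` from the `R`-algebras with codomain `Y` to the vertical maps with codomain
`Y`, i.e. the restriction of `U` to the fibres over `Y` of the codomain functors. -/
abbrev UFiber (Y : E) : (W.U ⋙ cod p).Fiber Y ⥤ (cod p).Fiber Y :=
  restrictFiber W.U (W.U ⋙ cod p) (cod p) rfl Y

/-- The pointed endofunctor `R` restricted to the slice `E/Y` of vertical maps into `Y`. -/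
abbrev RFiber (Y : E) : (cod p).Fiber Y ⥤ (cod p).Fiber Y :=
  restrictFiber W.R (cod p) (cod p) rfl Y

theorem pointFiber_aux {Y : E} (g : (cod p).Fiber Y) :
    (cod p).IsHomLift (𝟙 Y) (W.point.app g.1) := by
  obtain ⟨g, rfl⟩ := g
  exact Functor.IsHomLift.map (p := cod p) (W.point.app g)

/-- The point `g ⟶ R g` of `R` restricted to `E/Y`. -/
@[simps]
def pointFiber (Y : E) : 𝟭 ((cod p).Fiber Y) ⟶ W.RFiber Y where
  app g := ⟨W.point.app g.1, (pointFiber_aux W g)⟩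
  naturality _ _ a := Subtype.ext (W.point.naturality a.1)

section Slice

variable {Y : E} [HasBinaryCoproducts ((cod p).Fiber Y)] (f : (cod p).Fiber Y)

/-- For a vertical map `f : X ⟶ Y`, the endofunctor of `E/Y` sending `g` to the coproduct
`X ⊔ K g ⟶ Y` of `f` and `R g`. -/
def sliceEndo : (cod p).Fiber Y ⥤ (cod p).Fiber Y :=
  W.RFiber Y ⋙ coprod.functor.obj f

/-- The point of `sliceEndo`: the map `L g` into `K g`, followed by the coproduct inclusion. -/
def slicePoint : 𝟭 ((cod p).Fiber Y) ⟶ W.sliceEndo f where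
  app g := (W.pointFiber Y).app g ≫ coprod.inr
  naturality _ _ a := by
    have h₁ := (W.pointFiber Y).naturality a
    have h₂ := coprod.inr_map (𝟙 f) ((W.RFiber Y).map a)
    exact (Category.assoc _ _ _).symm.trans ((congrArg (· ≫ coprod.inr) h₁).trans
      ((Category.assoc _ _ _).trans ((congrArg ((W.pointFiber Y).app _ ≫ ·) h₂.symm).trans
        (Category.assoc _ _ _).symm)))

end Slice

/-- A comultiplication `Σ : L ⟹ L²`, vertical over `dom`, making `L` a comonad over
`dom : V(E) ⥤ E`. -/
structure Comult where
  δ : W.L ⟶ W.L ⋙ W.L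
  left_δ : ∀ f, (δ.app f).left = 𝟙 f.left
  left_counit : ∀ f, δ.app f ≫ W.counit.app (W.L.obj f) = 𝟙 (W.L.obj f)
  right_counit : ∀ f, δ.app f ≫ W.L.map (W.counit.app f) = 𝟙 (W.L.obj f)
  coassoc : ∀ f, δ.app f ≫ W.L.map (δ.app f) = δ.app f ≫ δ.app (W.L.obj f)

/-- A multiplication `Π : R² ⟹ R`, vertical over `cod`, making `R` a monad over
`cod : V(E) ⥤ E`. -/
structure Mult where
  μ : W.R ⋙ W.R ⟶ W.R
  right_μ : ∀ f, (μ.app f).right = 𝟙 f.right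
  left_unit : ∀ f, W.point.app (W.R.obj f) ≫ μ.app f = 𝟙 (W.R.obj f)
  right_unit : ∀ f, W.R.map (W.point.app f) ≫ μ.app f = 𝟙 (W.R.obj f)
  assoc : ∀ f, W.R.map (μ.app f) ≫ μ.app f = μ.app (W.R.obj f) ≫ μ.app f

variable {W}

/-- The comonad `(L, Σ)` on `V(E)`. -/
def Comult.comonad (c : W.Comult) : Comonad (VertArrow p) where
  toFunctor := W.L
  ε := W.counit
  δ := c.δ
  coassoc := c.coassoc
  left_counit := c.left_counit
  right_counit := c.right_counit

/-- The monad `(R, Π)` on `V(E)`. -/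
def Mult.monad (c : W.Mult) : Monad (VertArrow p) where
  toFunctor := W.R
  η := W.point
  μ := c.μ
  assoc := c.assoc
  left_unit := c.left_unit
  right_unit := c.right_unit

/-- The canonical natural transformation `LR ⟹ RL`: at `f` it is the square with top side
`Σ f : K f ⟶ K (L f)` and bottom side `Π f : K (R f) ⟶ K f`. -/
@[simps]
def canonical (c : W.Comult) (d : W.Mult) :
    W.R ⋙ W.L ⟶ W.L ⋙ W.R where
  app f := ⟨(c.δ.app f).right, (d.μ.app f).left, by
    have h₁ := congrArg VertArrow.Hom.right (c.left_counit f)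
    have h₂ := congrArg VertArrow.Hom.left (d.left_unit f)
    exact h₁.trans h₂.symm⟩
  naturality _ _ a := VertArrow.hom_ext
    (congrArg VertArrow.Hom.right (c.δ.naturality a))
    (congrArg VertArrow.Hom.left (d.μ.naturality a))

end FunctorialFactorisation

/-- `Δ : GT ⟹ TG` is a distributive law of the comonad `G` over the monad `T`. -/
structure IsDistributiveLaw {C : Type*} [Category* C] (G : Comonad C) (T : Monad C)
    (Δ : T.toFunctor ⋙ G.toFunctor ⟶ G.toFunctor ⋙ T.toFunctor) : Prop where
  unit : ∀ X, G.map (T.η.app X) ≫ Δ.app X = T.η.app (G.obj X)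
  mul : ∀ X, G.map (T.μ.app X) ≫ Δ.app X =
    Δ.app (T.obj X) ≫ T.map (Δ.app X) ≫ T.μ.app (G.obj X)
  counit : ∀ X, Δ.app X ≫ T.map (G.ε.app X) = G.ε.app (T.obj X)
  comul : ∀ X, Δ.app X ≫ T.map (G.δ.app X) =
    G.δ.app (T.obj X) ≫ G.map (Δ.app X) ≫ Δ.app (G.obj X)

/-! ### Lawfs's and awfs's -/

/-- A left half of an algebraic weak factorisation system (lawfs) over `p`. -/
structure Lawfs (p : E ⥤ B) where
  fact : FunctorialFactorisation p
  comult : fact.Comult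

/-- An algebraic weak factorisation system (awfs) over `p`. -/
structure Awfs (p : E ⥤ B) where
  fact : FunctorialFactorisation p
  comult : fact.Comult
  mult : fact.Mult
  distrib : IsDistributiveLaw comult.comonad mult.monad
    (FunctorialFactorisation.canonical comult mult)

/-- The underlying lawfs of an awfs. -/
@[simps]
def Awfs.toLawfs {p : E ⥤ B} (A : Awfs p) : Lawfs p := ⟨A.fact, A.comult⟩

/-- A morphism of functorial factorisations `(L, R) ⟶ (L', R')`: maps `ξ f : K f ⟶ K' f`, natural
in `f`, with `ξ f ∘ L f = L' f` and `R' f ∘ ξ f = R f`. -/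
structure FunctorialFactorisation.Hom {p : E ⥤ B} (W W' : FunctorialFactorisation p) where
  ξ : W.K ⟶ W'.K
  l_ξ : ∀ f, W.l.app f ≫ ξ.app f = W'.l.app f
  ξ_r : ∀ f, ξ.app f ≫ W'.r.app f = W.r.app f

namespace FunctorialFactorisation.Hom

variable {p : E ⥤ B} {W W' : FunctorialFactorisation p} (h : W.Hom W')

/-- The induced natural transformation `L ⟹ L'`. -/
@[simps]
def homL : W.L ⟶ W'.L where
  app f := ⟨𝟙 _, h.ξ.app f, (Category.id_comp _).trans (h.l_ξ f).symm⟩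
  naturality _ _ a := VertArrow.hom_ext ((Category.comp_id _).trans (Category.id_comp _).symm)
    (h.ξ.naturality a)

/-- The induced natural transformation `R ⟹ R'`. -/
@[simps]
def homR : W.R ⟶ W'.R where
  app f := ⟨h.ξ.app f, 𝟙 _, (h.ξ_r f).trans (Category.comp_id _).symm⟩
  naturality _ _ a := VertArrow.hom_ext (h.ξ.naturality a)
    ((Category.comp_id _).trans (Category.id_comp _).symm)

theorem point_homR (f : VertArrow p) : W.point.app f ≫ h.homR.app f = W'.point.app f :=
  VertArrow.hom_ext (h.l_ξ f) (Category.comp_id _)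

/-- The induced functor from `R'`-algebras to `R`-algebras. -/
@[simps]
def algebraFunctor : W'.RAlg ⥤ W.RAlg where
  obj X := ⟨X.carrier, h.homR.app X.carrier ≫ X.str,
    (Category.assoc _ _ _).symm.trans
      ((congrArg (· ≫ X.str) (h.point_homR X.carrier)).trans X.unit)⟩
  map {X Y} a := ⟨a.hom, by
    have h₁ := h.homR.naturality a.hom
    exact (Category.assoc _ _ _).symm.trans ((congrArg (· ≫ Y.str) h₁).trans
      ((Category.assoc _ _ _).trans ((congrArg (h.homR.app X.carrier ≫ ·) a.comm).trans
        (Category.assoc _ _ _).symm)))⟩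

end FunctorialFactorisation.Hom

/-- A morphism of lawfs's: a morphism of functorial factorisations that respects the
comultiplications. -/
structure Lawfs.Hom {p : E ⥤ B} (W W' : Lawfs p) extends
    FunctorialFactorisation.Hom W.fact W'.fact where
  comult_comm : ∀ f, toHom.homL.app f ≫ W'.comult.δ.app f =
    W.comult.δ.app f ≫ W.fact.L.map (toHom.homL.app f) ≫ toHom.homL.app (W'.fact.L.obj f)

/-- The forgetful functor from algebras over the monad `(R, Π)` to algebras over the pointed
endofunctor `R`. -/
@[simps]
def FunctorialFactorisation.Mult.forget {p : E ⥤ B} {W : FunctorialFactorisation p}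
    (d : W.Mult) : d.monad.Algebra ⥤ W.RAlg where
  obj X := ⟨X.A, X.a, X.unit⟩
  map a := ⟨a.f, a.h⟩

/-- An awfs `A` is algebraically free on the lawfs `W` if it comes with a morphism of lawfs's
`ξ : W ⟶ A` such that the induced functor from algebras over the monad of `A` to algebras over the
pointed endofunctor of `W` is an isomorphism of categories. -/
def Awfs.IsAlgebraicallyFreeOn {p : E ⥤ B} (A : Awfs p) (W : Lawfs p) : Prop :=
  ∃ ξ : W.Hom A.toLawfs, (A.mult.forget ⋙ ξ.toHom.algebraFunctor).IsIso

/-! ### Bifibrations, hom objects and universal lifting problems -/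

/-- `q` is an opfibration: every map out of `q X` has an opcartesian lift with domain `X`. -/
class IsOpfibration {D : Type*} [Category* D] {S : Type*} [Category* S] (q : D ⥤ S) : Prop where
  exists_lift : ∀ (X : D) {T : S} (u : q.obj X ⟶ T),
    ∃ (Y : D) (φ : X ⟶ Y), q.IsStronglyCocartesian u φ

/-- `p` is locally small: for all `X`, `Y` over `I`, the functor sending `u : J ⟶ I` to the set of
vertical maps `u^* X ⟶ u^* Y`, equivalently of maps `u^* X ⟶ Y` over `u`, is representable. The
representing object is `h₀ : H ⟶ I`, with universal map `h₁ : h₀^* X ⟶ Y` over `h₀`. -/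
class LocallySmall (p : E ⥤ B) : Prop where
  exists_hom : ∀ (I : B) (X Y : p.Fiber I),
    ∃ (H : B) (h₀ : H ⟶ I) (Z : E) (l : Z ⟶ X.1) (h₁ : Z ⟶ Y.1),
      p.IsStronglyCartesian h₀ l ∧ p.IsHomLift h₀ h₁ ∧
      ∀ (J : B) (u : J ⟶ I) (Z' : E) (l' : Z' ⟶ X.1) (h' : Z' ⟶ Y.1),
        p.IsStronglyCartesian u l' → p.IsHomLift u h' →
        ∃! t : J ⟶ H, t ≫ h₀ = u ∧
          ∃ t' : Z' ⟶ Z, p.IsHomLift t t' ∧ t' ≫ l = l' ∧ t' ≫ h₁ = h'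

/-- A morphism is cartesian if it is cartesian over its image. -/
def IsCartesianMap (p : E ⥤ B) {X Y : E} (f : X ⟶ Y) : Prop :=
  p.IsStronglyCartesian (p.map f) f

variable {p : E ⥤ B}

/-- The universal family of lifting problems from `m` to `f`. A family of lifting problems is a
span `m ⟵ z ⟶ f` in `V(E)` whose left leg is (levelwise) cartesian, so that `z` is the reindexing
`σ^* m` for some `σ`; the universal one is such that every other one is obtained from it by
reindexing along a unique map. -/
structure UniversalLiftingProblem (m f : VertArrow p) where
  z : VertArrow p
  toM : z ⟶ m
  toF : z ⟶ f
  cart_left : IsCartesianMap p toM.left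
  cart_right : IsCartesianMap p toM.right
  univ : ∀ (z' : VertArrow p) (a : z' ⟶ m) (b : z' ⟶ f), IsCartesianMap p a.left →
    IsCartesianMap p a.right → ∃! t : z' ⟶ z, t ≫ toM = a ∧ t ≫ toF = b

theorem lift_dom {X Y : E} {f : X ⟶ Y} {I J : B} {u : I ⟶ J} (_ : p.IsHomLift u f) :
    p.obj X = I :=
  IsHomLift.domain_eq p u f

theorem lift_cod {X Y : E} {f : X ⟶ Y} {I J : B} {u : I ⟶ J} (_ : p.IsHomLift u f) :
    p.obj Y = J :=
  IsHomLift.codomain_eq p u f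

theorem isStronglyCartesian_of_lift {X Y : E} {f : X ⟶ Y} (h : IsCartesianMap p f) {I J : B}
    (u : I ⟶ J) (hu : p.IsHomLift u f) : p.IsStronglyCartesian u f := by
  cases hu; exact h

theorem isCartesianMap_of {X Y : E} {f : X ⟶ Y} {I J : B}
    (u : I ⟶ J) (h : p.IsStronglyCartesian u f) : IsCartesianMap p f := by
  have := h.toIsHomLift
  cases this; exact h

/-- In a commutative square with vertical sides, both horizontal maps lie over the same map. -/
theorem lift_right {A C U V : E} {n : A ⟶ C} {m : U ⟶ V} {a : A ⟶ U} {c : C ⟶ V} {I J : B}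
    (hn : p.IsHomLift (𝟙 I) n) (hm : p.IsHomLift (𝟙 J) m) (w : a ≫ m = n ≫ c) (u : I ⟶ J)
    (ha : p.IsHomLift u a) : p.IsHomLift u c := by
  have hA := IsHomLift.domain_eq p u a
  have hC := IsHomLift.codomain_eq p (𝟙 I) n
  have hV := IsHomLift.codomain_eq p (𝟙 J) m
  have h := congrArg p.map w
  rw [p.map_comp, p.map_comp, IsHomLift.fac' p u a, IsHomLift.fac' p (𝟙 I) n,
    IsHomLift.fac' p (𝟙 J) m] at h
  apply IsHomLift.of_fac' p u c hC hV
  have h' := congrArg (fun k => eqToHom (hC.trans hA.symm) ≫ k) h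
  simpa using h'.symm

theorem isVertical_of_lift {X Y : E} {f : X ⟶ Y} {I : B} (h : p.IsHomLift (𝟙 I) f) :
    IsVertical p f := by
  have hX := IsHomLift.domain_eq p (𝟙 I) f
  subst hX; exact h

theorem lift_of_isVertical {X Y : E} {f : X ⟶ Y} {I : B} (h : IsVertical p f) (hX : p.obj X = I) :
    p.IsHomLift (𝟙 I) f := by
  subst hX; exact h

section ExistsUniversal

theorem exists_cart (p : E ⥤ B) [p.IsFibered] {X : E} {I J : B} (hX : p.obj X = J) (u : I ⟶ J) :
    ∃ (X' : E) (φ : X' ⟶ X), p.IsStronglyCartesian u φ := by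
  obtain ⟨X', φ, h⟩ := IsPreFibered.exists_isCartesian p hX u
  exact ⟨X', φ, inferInstance⟩

theorem cart_lift {X Y Z : E} {I J K : B} {f : X ⟶ Y} {u : I ⟶ J}
    (h : p.IsStronglyCartesian u f) (g : Z ⟶ Y) (v : K ⟶ I) (hg : p.IsHomLift (v ≫ u) g) :
    ∃ k : Z ⟶ X, p.IsHomLift v k ∧ k ≫ f = g :=
  (Functor.IsStronglyCartesian.universal_property p u f v (v ≫ u) rfl g).exists

theorem cart_ext {X Y Z : E} {I J K : B} {f : X ⟶ Y} {u : I ⟶ J}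
    (h : p.IsStronglyCartesian u f) {a b : Z ⟶ X} (v : K ⟶ I) (ha : p.IsHomLift v a)
    (hb : p.IsHomLift v b) (w : a ≫ f = b ≫ f) : a = b :=
  Functor.IsStronglyCartesian.ext p u f v w

variable [p.IsFibered] [HasFiniteLimits B] [LocallySmall p]

/-- For `X` over `I` and `Y` over `J` there is a universal pair of maps
`σ : H ⟶ I`, `τ : H ⟶ J` together with a map `σ^* X ⟶ Y` over `τ`. -/
theorem exists_hom_span {I J : B} {X Y : E} (hX : p.obj X = I) (hY : p.obj Y = J) :
    ∃ (H : B) (σ : H ⟶ I) (τ : H ⟶ J) (Z : E) (l : Z ⟶ X) (r : Z ⟶ Y),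
      p.IsStronglyCartesian σ l ∧ p.IsHomLift τ r ∧
      ∀ (K : B) (σ' : K ⟶ I) (τ' : K ⟶ J) (Z' : E) (l' : Z' ⟶ X) (r' : Z' ⟶ Y),
        p.IsStronglyCartesian σ' l' → p.IsHomLift τ' r' →
        ∃! t : K ⟶ H, t ≫ σ = σ' ∧ t ≫ τ = τ' ∧
          ∃ t' : Z' ⟶ Z, p.IsHomLift t t' ∧ t' ≫ l = l' ∧ t' ≫ r = r' := by
  obtain ⟨X', x, hx⟩ := exists_cart p hX (prod.fst : I ⨯ J ⟶ I)
  obtain ⟨Y', y, hy⟩ := exists_cart p hY (prod.snd : I ⨯ J ⟶ J)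
  obtain ⟨H, h₀, Z, l, h₁, hl, hh, huniv⟩ := LocallySmall.exists_hom (p := p) (I ⨯ J)
    ⟨X', lift_dom hx.toIsHomLift⟩ ⟨Y', lift_dom hy.toIsHomLift⟩
  dsimp only at l h₁ hl hh huniv
  refine ⟨H, h₀ ≫ prod.fst, h₀ ≫ prod.snd, Z, l ≫ x, h₁ ≫ y, inferInstance, inferInstance, ?_⟩
  intro K σ' τ' Z' l' r' hl' hr'
  have e₁ : prod.lift σ' τ' ≫ prod.fst = σ' := prod.lift_fst _ _
  have e₂ : prod.lift σ' τ' ≫ prod.snd = τ' := prod.lift_snd _ _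
  obtain ⟨l'', hl'', el⟩ := cart_lift hx l' (prod.lift σ' τ') (by rw [e₁]; infer_instance)
  obtain ⟨r'', hr'', er⟩ := cart_lift hy r' (prod.lift σ' τ') (by rw [e₂]; infer_instance)
  have hc : p.IsStronglyCartesian (prod.lift σ' τ') l'' := by
    have : p.IsStronglyCartesian (prod.lift σ' τ' ≫ prod.fst) (l'' ≫ x) := by
      rw [e₁, el]; exact hl'
    exact Functor.IsStronglyCartesian.of_comp p (g := prod.fst) (ψ := x)
  obtain ⟨t, ⟨ht, t', ht', tl, tr⟩, uniq⟩ := huniv K _ Z' l'' r'' hc hr''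
  refine ⟨t, ⟨?_, ?_, t', ht', ?_, ?_⟩, ?_⟩
  · rw [← Category.assoc, ht, e₁]
  · rw [← Category.assoc, ht, e₂]
  · rw [← Category.assoc, tl, el]
  · rw [← Category.assoc, tr, er]
  · rintro s ⟨s₁, s₂, s', hs', sl, sr⟩
    have hs : s ≫ h₀ = prod.lift σ' τ' := by
      apply Limits.prod.hom_ext
      · rw [e₁, Category.assoc, s₁]
      · rw [e₂, Category.assoc, s₂]
    have k₁ : p.IsHomLift (prod.lift σ' τ') (s' ≫ l) := by rw [← hs]; infer_instance
    have k₂ : p.IsHomLift (prod.lift σ' τ') (s' ≫ h₁) := by rw [← hs]; infer_instance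
    exact uniq s ⟨hs, s', hs', cart_ext hx _ k₁ hl'' (by rw [Category.assoc, sl, el]),
      cart_ext hy _ k₂ hr'' (by rw [Category.assoc, sr, er])⟩

/-- Over a locally small fibration whose base has finite limits, universal families of lifting
problems exist. -/
theorem UniversalLiftingProblem.nonempty (m f : VertArrow p) :
    Nonempty (UniversalLiftingProblem m f) := by
  have hm : p.IsHomLift (𝟙 (p.obj m.left)) m.hom := m.vertical
  have hf : p.IsHomLift (𝟙 (p.obj f.left)) f.hom := f.vertical
  obtain ⟨H₁, σ₁, τ₁, Z₁, l₁, r₁, hl₁, hr₁, u₁⟩ := exists_hom_span (p := p)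
    (lift_cod hm) (lift_cod hf)
  obtain ⟨H₂, σ₂, τ₂, Z₂, l₂, r₂, hl₂, hr₂, u₂⟩ := exists_hom_span (p := p)
    (rfl : p.obj m.left = _) (rfl : p.obj f.left = _)
  obtain ⟨H₃, σ₃, τ₃, Z₃, l₃, r₃, hl₃, hr₃, u₃⟩ := exists_hom_span (p := p)
    (rfl : p.obj m.left = _) (lift_cod hf)
  obtain ⟨A₁, a₁, ha₁⟩ := exists_cart p (rfl : p.obj m.left = _) σ₁
  obtain ⟨m₁, hm₁, em₁⟩ := cart_lift hl₁ (a₁ ≫ m.hom) (𝟙 H₁) (by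
    rw [Category.id_comp]; infer_instance)
  obtain ⟨d₁, ⟨d₁σ, d₁τ, d₁', hd₁, d₁l, d₁r⟩, -⟩ := u₃ H₁ σ₁ τ₁ A₁ a₁ (m₁ ≫ r₁) ha₁ inferInstance
  obtain ⟨d₂, ⟨d₂σ, d₂τ, d₂', hd₂, d₂l, d₂r⟩, -⟩ := u₃ H₂ σ₂ τ₂ Z₂ l₂ (r₂ ≫ f.hom) hl₂
    inferInstance
  have hK : pullback.fst d₁ d₂ ≫ d₁ = pullback.snd d₁ d₂ ≫ d₂ := pullback.condition
  have hσ : pullback.fst d₁ d₂ ≫ σ₁ = pullback.snd d₁ d₂ ≫ σ₂ := by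
    rw [← d₁σ, ← d₂σ, ← Category.assoc, hK, Category.assoc]
  have hτ : pullback.fst d₁ d₂ ≫ τ₁ = pullback.snd d₁ d₂ ≫ τ₂ := by
    rw [← d₁τ, ← d₂τ, ← Category.assoc, hK, Category.assoc]
  obtain ⟨C, c, hc⟩ := exists_cart p (lift_dom hl₁.toIsHomLift) (pullback.fst d₁ d₂)
  obtain ⟨A, e₁, he₁⟩ := exists_cart p (lift_dom ha₁.toIsHomLift) (pullback.fst d₁ d₂)
  obtain ⟨n, hn, en⟩ := cart_lift hc (e₁ ≫ m₁) (𝟙 _) (by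
    rw [Category.id_comp]; infer_instance)
  obtain ⟨e₂, he₂, ee₂⟩ := cart_lift hl₂ (e₁ ≫ a₁) (pullback.snd d₁ d₂) (by
    rw [← hσ]; infer_instance)
  have hed : e₂ ≫ d₂' = e₁ ≫ d₁' := by
    refine cart_ext hl₃ (pullback.snd d₁ d₂ ≫ d₂) inferInstance ?_ ?_
    · rw [← hK]; infer_instance
    · rw [Category.assoc, d₂l, ee₂, Category.assoc, d₁l]
  refine ⟨⟨⟨A, C, n, isVertical_of_lift hn⟩, ⟨e₁ ≫ a₁, c ≫ l₁, ?_⟩, ⟨e₂ ≫ r₂, c ≫ r₁, ?_⟩,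
    ?_, ?_, ?_⟩⟩
  · dsimp only
    rw [Category.assoc, ← em₁, ← Category.assoc, ← en, Category.assoc]
  · dsimp only
    rw [Category.assoc, ← d₂r, ← Category.assoc, hed, Category.assoc, d₁r, ← Category.assoc, ← en,
      Category.assoc]
  · exact isCartesianMap_of (pullback.fst d₁ d₂ ≫ σ₁) inferInstance
  · exact isCartesianMap_of (pullback.fst d₁ d₂ ≫ σ₁) inferInstance
  · intro z' a b hal har
    have hz : p.IsHomLift (𝟙 (p.obj z'.left)) z'.hom := z'.vertical
    have hal' : p.IsStronglyCartesian (p.map a.left) a.left := hal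
    have har' : p.IsStronglyCartesian (p.map a.left) a.right :=
      isStronglyCartesian_of_lift har _ (lift_right hz hm a.w _ inferInstance)
    have hbr : p.IsHomLift (p.map b.left) b.right := lift_right hz hf b.w _ inferInstance
    obtain ⟨t₁, ⟨t₁σ, t₁τ, s₁, hs₁, s₁l, s₁r⟩, uq₁⟩ :=
      u₁ _ (p.map a.left) (p.map b.left) _ a.right b.right har' hbr
    obtain ⟨t₂, ⟨t₂σ, t₂τ, s₂, hs₂, s₂l, s₂r⟩, uq₂⟩ :=
      u₂ _ (p.map a.left) (p.map b.left) _ a.left b.left hal' inferInstance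
    obtain ⟨s, hs, sa⟩ := cart_lift ha₁ a.left t₁ (by rw [t₁σ]; infer_instance)
    have sm : s ≫ m₁ = z'.hom ≫ s₁ := by
      refine cart_ext hl₁ t₁ inferInstance inferInstance ?_
      rw [Category.assoc, em₁, ← Category.assoc, sa, a.w, Category.assoc, s₁l]
    have ht : t₁ ≫ d₁ = t₂ ≫ d₂ := by
      refine (u₃ _ (p.map a.left) (p.map b.left) _ a.left (b.left ≫ f.hom) hal'
        inferInstance).unique ⟨?_, ?_, s ≫ d₁', inferInstance, ?_, ?_⟩
        ⟨?_, ?_, s₂ ≫ d₂', inferInstance, ?_, ?_⟩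
      · rw [Category.assoc, d₁σ, t₁σ]
      · rw [Category.assoc, d₁τ, t₁τ]
      · rw [Category.assoc, d₁l, sa]
      · rw [Category.assoc, d₁r, ← Category.assoc, sm, Category.assoc, s₁r, b.w]
      · rw [Category.assoc, d₂σ, t₂σ]
      · rw [Category.assoc, d₂τ, t₂τ]
      · rw [Category.assoc, d₂l, s₂l]
      · rw [Category.assoc, d₂r, ← Category.assoc, s₂r]
    have tf : pullback.lift t₁ t₂ ht ≫ pullback.fst d₁ d₂ = t₁ := pullback.lift_fst _ _ _
    have ts : pullback.lift t₁ t₂ ht ≫ pullback.snd d₁ d₂ = t₂ := pullback.lift_snd _ _ _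
    obtain ⟨q, hq, qe⟩ := cart_lift he₁ s (pullback.lift t₁ t₂ ht) (by rw [tf]; infer_instance)
    obtain ⟨q', hq', qc⟩ := cart_lift hc s₁ (pullback.lift t₁ t₂ ht) (by rw [tf]; infer_instance)
    have qw : q ≫ n = z'.hom ≫ q' := by
      refine cart_ext hc (pullback.lift t₁ t₂ ht) inferInstance inferInstance ?_
      rw [Category.assoc, en, ← Category.assoc, qe, sm, Category.assoc, qc]
    have qs : q ≫ e₂ = s₂ := by
      refine cart_ext hl₂ t₂ (by rw [← ts]; infer_instance) inferInstance ?_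
      rw [Category.assoc, ee₂, ← Category.assoc, qe, sa, s₂l]
    refine ⟨⟨q, q', qw⟩, ⟨VertArrow.hom_ext ?_ ?_, VertArrow.hom_ext ?_ ?_⟩, ?_⟩
    · change q ≫ e₁ ≫ a₁ = _
      rw [← Category.assoc, qe, sa]
    · change q' ≫ c ≫ l₁ = _
      rw [← Category.assoc, qc, s₁l]
    · change q ≫ e₂ ≫ r₂ = _
      rw [← Category.assoc, qs, s₂r]
    · change q' ≫ c ≫ r₁ = _
      rw [← Category.assoc, qc, s₁r]
    · rintro ⟨y, y', yw⟩ ⟨ya, yb⟩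
      have ya₁ : y ≫ e₁ ≫ a₁ = a.left := congrArg VertArrow.Hom.left ya
      have ya₂ : y' ≫ c ≫ l₁ = a.right := congrArg VertArrow.Hom.right ya
      have yb₁ : y ≫ e₂ ≫ r₂ = b.left := congrArg VertArrow.Hom.left yb
      have yb₂ : y' ≫ c ≫ r₁ = b.right := congrArg VertArrow.Hom.right yb
      dsimp only at y y' yw
      obtain ⟨v, hv⟩ : ∃ v : p.obj z'.left ⟶ pullback d₁ d₂, p.IsHomLift v y :=
        ⟨p.map y ≫ eqToHom (lift_dom he₁.toIsHomLift), inferInstance⟩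
      have hv' : p.IsHomLift v y' := lift_right hz hn yw v hv
      have vσ : (v ≫ pullback.fst d₁ d₂) ≫ σ₁ = p.map a.left := by
        have : p.IsHomLift ((v ≫ pullback.fst d₁ d₂) ≫ σ₁) a.left := by
          rw [← ya₁, Category.assoc]; infer_instance
        exact IsHomLift.eq_of_isHomLift p _ a.left
      have vτ : (v ≫ pullback.snd d₁ d₂) ≫ τ₂ = p.map b.left := by
        have : p.IsHomLift ((v ≫ pullback.snd d₁ d₂) ≫ τ₂) b.left := by
          rw [← yb₁, Category.assoc]; infer_instance
        exact IsHomLift.eq_of_isHomLift p _ b.left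
      have v₁ : v ≫ pullback.fst d₁ d₂ = t₁ :=
        uq₁ _ ⟨vσ, by rw [Category.assoc, hτ, ← Category.assoc, vτ], y' ≫ c, inferInstance,
          by rw [Category.assoc, ya₂], by rw [Category.assoc, yb₂]⟩
      have v₂ : v ≫ pullback.snd d₁ d₂ = t₂ :=
        uq₂ _ ⟨by rw [Category.assoc, ← hσ, ← Category.assoc, vσ], vτ, y ≫ e₂, inferInstance,
          by rw [Category.assoc, ee₂, ya₁], by rw [Category.assoc, yb₁]⟩
      have hvt : v = pullback.lift t₁ t₂ ht := by
        apply pullback.hom_ext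
        · rw [v₁, tf]
        · rw [v₂, ts]
      subst hvt
      have : p.IsStronglyCartesian (pullback.fst d₁ d₂ ≫ σ₁) (e₁ ≫ a₁) := inferInstance
      have : p.IsStronglyCartesian (pullback.fst d₁ d₂ ≫ σ₁) (c ≫ l₁) := inferInstance
      refine VertArrow.hom_ext ?_ ?_
      · refine cart_ext (u := pullback.fst d₁ d₂ ≫ σ₁) (f := e₁ ≫ a₁) inferInstance
          (pullback.lift t₁ t₂ ht) hv hq ?_
        rw [ya₁, ← Category.assoc, qe, sa]
      · refine cart_ext (u := pullback.fst d₁ d₂ ≫ σ₁) (f := c ≫ l₁) inferInstance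
          (pullback.lift t₁ t₂ ht) hv' hq' ?_
        rw [ya₂, ← Category.assoc, qc, s₁l]

end ExistsUniversal

/-! ### Step-one of the small object argument -/

/-- The choices entering step-one for `m` at a vertical map `f : X ⟶ Y`: the universal family of
lifting problems `z ⟶ f` from `m` to `f`, and an opcartesian lift over `dom` of its top map
`dom z ⟶ X`. The codomain of the lift is `l : X ⟶ K`. (In `E` this is the pushout of `z` along its
top map.) -/
structure StepOneData (m f : VertArrow p) where
  ulp : UniversalLiftingProblem m f
  K : E
  l : f.left ⟶ K
  vertical_l : IsVertical p l
  push : ulp.z ⟶ ⟨f.left, K, l, vertical_l⟩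
  push_left : push.left = ulp.toF.left
  opcartesian : (dom p).IsStronglyCocartesian push.left push

theorem StepOneData.nonempty [p.IsFibered] [HasFiniteLimits B] [LocallySmall p]
    [IsOpfibration (dom p)] (m f : VertArrow p) : Nonempty (StepOneData m f) := by
  obtain ⟨U⟩ := UniversalLiftingProblem.nonempty m f
  obtain ⟨w, φ, hφ⟩ := IsOpfibration.exists_lift (q := dom p) U.z
    (show (dom p).obj U.z ⟶ f.left from U.toF.left)
  have hw : w.left = f.left := IsHomLift.codomain_eq (dom p) U.toF.left φ
  obtain ⟨w₁, w₂, i, hi⟩ := w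
  dsimp only at hw
  subst hw
  have e : U.toF.left = φ.left := IsHomLift.eq_of_isHomLift (dom p) _ φ
  exact ⟨⟨U, w₂, i, hi, φ, e.symm, by rw [← e]; exact hφ⟩⟩

namespace StepOneData

variable {m f g h : VertArrow p} (s : StepOneData m f) (s' : StepOneData m g)

/-- The left map `L₁ f : X ⟶ K₁ f`, as an object of `V(E)`. -/
abbrev obj : VertArrow p := ⟨f.left, s.K, s.l, s.vertical_l⟩

theorem existsUnique_desc {w : VertArrow p} (u : s.ulp.z ⟶ w) (x : f.left ⟶ w.left)
    (hx : s.push.left ≫ x = u.left) : ∃! v : s.obj ⟶ w, v.left = x ∧ s.push ≫ v = u := by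
  have := s.opcartesian
  have hu : (dom p).IsHomLift (s.push.left ≫ x) u := by
    rw [hx]; exact Functor.IsHomLift.map (p := dom p) u
  obtain ⟨v, ⟨hv, ev⟩, uniq⟩ := Functor.IsStronglyCocartesian.universal_property (dom p)
    s.push.left s.push (S' := (dom p).obj w) x (s.push.left ≫ x) rfl u
  refine ⟨v, ⟨(IsHomLift.eq_of_isHomLift (dom p) (a := s.obj) (b := w) x v).symm, ev⟩, ?_⟩
  rintro v' ⟨hv', ev'⟩
  refine uniq v' ⟨?_, ev'⟩
  rw [← hv']
  exact Functor.IsHomLift.map (p := dom p) v'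

/-- Maps out of `L₁ f` given by the universal property of the opcartesian lift. -/
def desc {w : VertArrow p} (u : s.ulp.z ⟶ w) (x : f.left ⟶ w.left)
    (hx : s.push.left ≫ x = u.left) : s.obj ⟶ w :=
  (s.existsUnique_desc u x hx).choose

theorem desc_left {w : VertArrow p} (u : s.ulp.z ⟶ w) (x : f.left ⟶ w.left)
    (hx : s.push.left ≫ x = u.left) : (s.desc u x hx).left = x :=
  (s.existsUnique_desc u x hx).choose_spec.1.1

theorem push_desc {w : VertArrow p} (u : s.ulp.z ⟶ w) (x : f.left ⟶ w.left)
    (hx : s.push.left ≫ x = u.left) : s.push ≫ s.desc u x hx = u :=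
  (s.existsUnique_desc u x hx).choose_spec.1.2

theorem obj_ext {w : VertArrow p} {a b : s.obj ⟶ w} (h₁ : a.left = b.left)
    (h₂ : s.push ≫ a = s.push ≫ b) : a = b :=
  (s.existsUnique_desc (s.push ≫ b) b.left rfl).unique ⟨h₁, h₂⟩ ⟨rfl, rfl⟩

/-- Maps into the universal family of lifting problems given by its universal property. -/
def lift (b : s.ulp.z ⟶ g) : s.ulp.z ⟶ s'.ulp.z :=
  (s'.ulp.univ s.ulp.z s.ulp.toM b s.ulp.cart_left s.ulp.cart_right).choose

theorem lift_toM (b : s.ulp.z ⟶ g) : s.lift s' b ≫ s'.ulp.toM = s.ulp.toM :=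
  (s'.ulp.univ s.ulp.z s.ulp.toM b s.ulp.cart_left s.ulp.cart_right).choose_spec.1.1

theorem lift_toF (b : s.ulp.z ⟶ g) : s.lift s' b ≫ s'.ulp.toF = b :=
  (s'.ulp.univ s.ulp.z s.ulp.toM b s.ulp.cart_left s.ulp.cart_right).choose_spec.1.2

theorem z_ext {a b : s.ulp.z ⟶ s'.ulp.z} (ha : a ≫ s'.ulp.toM = s.ulp.toM)
    (hb : b ≫ s'.ulp.toM = s.ulp.toM) (hab : a ≫ s'.ulp.toF = b ≫ s'.ulp.toF) : a = b :=
  (s'.ulp.univ s.ulp.z s.ulp.toM (b ≫ s'.ulp.toF) s.ulp.cart_left s.ulp.cart_right).unique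
    ⟨ha, hab⟩ ⟨hb, rfl⟩

/-- The counit `L₁ f ⟶ f`: the vertical part of the factorisation of `z ⟶ f` as an opcartesian map
followed by a vertical map. -/
def counit : s.obj ⟶ f :=
  s.desc s.ulp.toF (𝟙 f.left) (by rw [s.push_left, Category.comp_id])

theorem counit_left : s.counit.left = 𝟙 f.left := s.desc_left _ _ _

theorem push_counit : s.push ≫ s.counit = s.ulp.toF := s.push_desc _ _ _

theorem map_aux (b : s.ulp.z ⟶ g) (x : f.left ⟶ g.left) (hb : b.left = s.push.left ≫ x) :
    s.push.left ≫ x = (s.lift s' b ≫ s'.push).left := by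
  rw [VertArrow.comp_left, s'.push_left, ← VertArrow.comp_left, lift_toF, hb]

/-- The action of `L₁` on a morphism `f ⟶ g`. -/
def map (a : f ⟶ g) : s.obj ⟶ s'.obj :=
  s.desc (s.lift s' (s.ulp.toF ≫ a) ≫ s'.push) a.left
    (s.map_aux s' _ _ (by rw [VertArrow.comp_left, s.push_left]))

theorem map_left (a : f ⟶ g) : (s.map s' a).left = a.left := s.desc_left _ _ _

theorem push_map (a : f ⟶ g) :
    s.push ≫ s.map s' a = s.lift s' (s.ulp.toF ≫ a) ≫ s'.push := s.push_desc _ _ _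

theorem map_id : s.map s (𝟙 f) = 𝟙 s.obj := by
  refine s.obj_ext (s.map_left s _) ?_
  have : s.lift s (s.ulp.toF ≫ 𝟙 f) = 𝟙 _ :=
    s.z_ext s (s.lift_toM _ _) (Category.id_comp _)
      (by rw [lift_toF, Category.comp_id, Category.id_comp])
  rw [push_map, this, Category.id_comp, Category.comp_id]

theorem map_comp (s'' : StepOneData m h) (a : f ⟶ g) (b : g ⟶ h) :
    s.map s'' (a ≫ b) = s.map s' a ≫ s'.map s'' b := by
  refine s.obj_ext ?_ ?_
  · rw [VertArrow.comp_left, map_left, map_left, map_left, VertArrow.comp_left]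
  have : s.lift s'' (s.ulp.toF ≫ a ≫ b) =
      s.lift s' (s.ulp.toF ≫ a) ≫ s'.lift s'' (s'.ulp.toF ≫ b) := by
    refine s.z_ext s'' (s.lift_toM _ _) ?_ ?_
    · rw [Category.assoc, lift_toM, lift_toM]
    · rw [lift_toF, Category.assoc, lift_toF, ← Category.assoc (s.lift s' _), lift_toF,
        Category.assoc]
  rw [push_map, this, ← Category.assoc s.push, push_map, Category.assoc, Category.assoc, push_map]

theorem map_counit (a : f ⟶ g) : s.map s' a ≫ s'.counit = s.counit ≫ a := by
  refine s.obj_ext ?_ ?_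
  · rw [VertArrow.comp_left, VertArrow.comp_left, map_left, counit_left, counit_left,
      Category.comp_id, Category.id_comp]
  · rw [← Category.assoc, push_map, Category.assoc, push_counit, lift_toF, ← Category.assoc,
      push_counit]

variable (t : StepOneData m s.obj)

/-- The comultiplication `L₁ f ⟶ L₁ (L₁ f)`. -/
def comult : s.obj ⟶ t.obj :=
  s.desc (s.lift t s.push ≫ t.push) (𝟙 f.left) (s.map_aux t s.push (𝟙 f.left)
    (Category.comp_id _).symm)

theorem comult_left : (s.comult t).left = 𝟙 f.left := s.desc_left _ _ _

theorem push_comult : s.push ≫ s.comult t = s.lift t s.push ≫ t.push := s.push_desc _ _ _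

theorem comult_counit : s.comult t ≫ t.counit = 𝟙 s.obj := by
  refine s.obj_ext ?_ ?_
  · rw [VertArrow.comp_left, comult_left, counit_left]
    exact Category.comp_id _
  · rw [← Category.assoc, push_comult, Category.assoc, push_counit, lift_toF, Category.comp_id]

theorem comult_map_counit : s.comult t ≫ t.map s s.counit = 𝟙 s.obj := by
  refine s.obj_ext ?_ ?_
  · rw [VertArrow.comp_left, comult_left, map_left, counit_left]
    exact Category.comp_id _
  · have : s.lift t s.push ≫ t.lift s (t.ulp.toF ≫ s.counit) = 𝟙 _ := by
      refine s.z_ext s ?_ (Category.id_comp _) ?_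
      · rw [Category.assoc, lift_toM, lift_toM]
      · rw [Category.assoc, lift_toF, ← Category.assoc, lift_toF, push_counit, Category.id_comp]
    rw [← Category.assoc, push_comult, Category.assoc, push_map, ← Category.assoc, this,
      Category.id_comp, Category.comp_id]

theorem comult_natural (t' : StepOneData m s'.obj) (a : f ⟶ g) :
    s.map s' a ≫ s'.comult t' = s.comult t ≫ t.map t' (s.map s' a) := by
  refine s.obj_ext ?_ ?_
  · rw [VertArrow.comp_left, VertArrow.comp_left, comult_left, comult_left, map_left, map_left,
      map_left]
    exact (Category.comp_id _).trans (Category.id_comp _).symm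
  · have : s.lift s' (s.ulp.toF ≫ a) ≫ s'.lift t' s'.push =
        s.lift t s.push ≫ t.lift t' (t.ulp.toF ≫ s.map s' a) := by
      refine s.z_ext t' ?_ ?_ ?_
      · rw [Category.assoc, lift_toM, lift_toM]
      · rw [Category.assoc, lift_toM, lift_toM]
      · rw [Category.assoc, lift_toF, Category.assoc, lift_toF, ← Category.assoc, lift_toF,
          push_map]
    rw [← Category.assoc, push_map, Category.assoc, push_comult, ← Category.assoc, this,
      ← Category.assoc, push_comult, Category.assoc, Category.assoc, push_map]

theorem comult_coassoc (t' : StepOneData m t.obj) :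
    s.comult t ≫ t.map t' (s.comult t) = s.comult t ≫ t.comult t' := by
  refine s.obj_ext ?_ ?_
  · rw [VertArrow.comp_left, VertArrow.comp_left, map_left, comult_left, comult_left]
  · have : s.lift t s.push ≫ t.lift t' (t.ulp.toF ≫ s.comult t) =
        s.lift t s.push ≫ t.lift t' t.push := by
      refine s.z_ext t' ?_ ?_ ?_
      · rw [Category.assoc, lift_toM, lift_toM]
      · rw [Category.assoc, lift_toM, lift_toM]
      · rw [Category.assoc, lift_toF, Category.assoc, lift_toF, ← Category.assoc, lift_toF,
          push_comult]
    rw [← Category.assoc, push_comult, Category.assoc, push_map, ← Category.assoc, this,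
      ← Category.assoc, push_comult, Category.assoc, Category.assoc, push_comult]

/-- The functorial factorisation obtained from the choices of step-one. -/
@[simps]
def factorisation {m : VertArrow p} (s : ∀ f, StepOneData m f) : FunctorialFactorisation p where
  K :=
    { obj := fun f => (s f).K
      map := fun {f g} a => ((s f).map (s g) a).right
      map_id := fun f => congrArg VertArrow.Hom.right (s f).map_id
      map_comp := fun {f g h} a b =>
        congrArg VertArrow.Hom.right ((s f).map_comp (s g) (s h) a b) }
  l :=
    { app := fun f => (s f).l
      naturality := fun f g a => by
        have h₁ := ((s f).map (s g) a).w
        rw [map_left] at h₁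
        exact h₁ }
  r :=
    { app := fun f => (s f).counit.right
      naturality := fun f g a =>
        congrArg VertArrow.Hom.right ((s f).map_counit (s g) a) }
  vertical_l := fun f => (s f).vertical_l
  vertical_r := fun f => isVertical_of_lift (I := p.obj f.left) (lift_right
    (I := p.obj f.left) (J := p.obj f.left) (s f).vertical_l f.vertical (s f).counit.w _ (by
      rw [counit_left]; infer_instance))
  fac := fun f => by
    have h₁ := (s f).counit.w
    rw [counit_left] at h₁
    exact h₁.symm.trans (Category.id_comp _)

theorem factorisation_L_map {m : VertArrow p} (s : ∀ f, StepOneData m f) {f g : VertArrow p}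
    (a : f ⟶ g) : (factorisation s).L.map a = (s f).map (s g) a :=
  VertArrow.hom_ext (map_left (s f) (s g) a).symm rfl

theorem factorisation_counit {m : VertArrow p} (s : ∀ f, StepOneData m f) (f : VertArrow p) :
    (factorisation s).counit.app f = (s f).counit :=
  VertArrow.hom_ext (s f).counit_left.symm rfl

/-- The lawfs obtained from the choices of step-one. -/
def lawfs {m : VertArrow p} (s : ∀ f, StepOneData m f) : Lawfs p where
  fact := factorisation s
  comult :=
    { δ :=
        { app := fun f => (s f).comult (s (s f).obj)
          naturality := fun f g a =>
            (congrArg (· ≫ (s g).comult (s (s g).obj)) (factorisation_L_map s a)).trans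
              (((s f).comult_natural (s g) (s (s f).obj) (s (s g).obj) a).trans
              (congrArg ((s f).comult (s (s f).obj) ≫ ·)
                ((factorisation_L_map s ((factorisation s).L.map a)).trans
                  (congrArg ((s (s f).obj).map (s (s g).obj))
                    (factorisation_L_map s a))).symm)) }
      left_δ := fun f => (s f).comult_left _
      left_counit := fun f =>
        (congrArg ((s f).comult (s (s f).obj) ≫ ·) (factorisation_counit s (s f).obj)).trans
          ((s f).comult_counit (s (s f).obj))
      right_counit := fun f =>
        (congrArg ((s f).comult (s (s f).obj) ≫ ·)
          ((factorisation_L_map s ((factorisation s).counit.app f)).trans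
            (congrArg ((s (s f).obj).map (s f)) (factorisation_counit s f)))).trans
          ((s f).comult_map_counit (s (s f).obj))
      coassoc := fun f =>
        (congrArg ((s f).comult (s (s f).obj) ≫ ·)
          (factorisation_L_map s ((s f).comult (s (s f).obj)))).trans
          ((s f).comult_coassoc (s (s f).obj) (s (s (s f).obj).obj)) }

end StepOneData

/-- Step-one of the small object argument, `(L₁, R₁)`, for a vertical map `m`. -/
def stepOne (p : E ⥤ B) [p.IsFibered] [HasFiniteLimits B] [LocallySmall p]
    [IsOpfibration (dom p)] (m : VertArrow p) : Lawfs p :=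
  StepOneData.lawfs fun f => (StepOneData.nonempty m f).some

/-- An awfs is cofibrantly generated by `m` if it is algebraically free on step-one. -/
def Awfs.IsCofibrantlyGeneratedBy (A : Awfs p) [p.IsFibered] [HasFiniteLimits B]
    [LocallySmall p] [IsOpfibration (dom p)] (m : VertArrow p) : Prop :=
  A.IsAlgebraicallyFreeOn (stepOne p m)

end

end FibredAwfs

open FibredAwfs

namespace FibredAwfs

noncomputable section

variable {B : Type u₁} [Category.{v₁} B] {E : Type u₂} [Category.{v₂} E] {p : E ⥤ B}

/-! The proof turns free `R`-algebras into an awfs. The mechanism is that the comultiplication of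
`L` lets algebras over the pointed endofunctor `R` be composed. Given structures `a` on `g : X ⟶ Y`
and `b` on `h : Y ⟶ Z`, put `f = g ≫ h`. The map `bot : K f ⟶ K h ⟶ Y` built from `b` gives a square
`L f ⟶ g`, and `K f ⟶ K (L f) ⟶ K g ⟶ X` is a structure on `f` (`compStr`). Naturality and
coassociativity make this composition functorial and associative.

Suppose every vertical `f` has a free `R`-algebra `F f`, with universal property for squares having
an arbitrary codomain component (`Free`). Its unit and underlying map are the new factorisation, and
freeness yields the monad. For the comonad, the algebras free on the new left map of `f` and on `f`
itself are composable, and the comultiplication is the algebra morphism from `F f` to their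
composite determined by the unit. The monad laws, the comonad laws and the hexagon `mul_comul`
compare algebra morphisms out of a free algebra over one codomain map, so they need only be checked
on the unit. An `R`-structure on `g` extends the identity uniquely to a map from the free algebra on
`g`; hence monad algebras and `R`-algebras coincide (`algebraComparison`).

It remains to produce free algebras. Since `cod` is a fibration, algebras can be reindexed along any
map of codomains, with a cartesian comparison (`exists_cart_str`), so an algebra that is free within
its fibre is free (`FiberFree.toFree`). An initial object of `(f ↓ U_Y)` is a fibrewise free
algebra. So is an initial algebra for `g ↦ X ⊔ K g`: a structure map out of the coproduct is a map
`f ⟶ g` together with a map `R g ⟶ g`, and the point lies in the second summand, so the unit law is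
that of an `R`-algebra. -/

theorem IsVertical.comp {X Y Z : E} {f : X ⟶ Y} {g : Y ⟶ Z} (hf : IsVertical p f)
    (hg : IsVertical p g) : IsVertical p (f ≫ g) := by
  have hf' : p.IsHomLift (𝟙 (p.obj X)) f := hf
  have hg' := lift_of_isVertical hg (lift_cod hf')
  exact isVertical_of_lift (I := p.obj X) inferInstance

/-- Identities cancel under `p`. This makes the unit of a free algebra vertical, the other two sides
of its triangle being so. -/
theorem IsVertical.of_comp {X Y Z : E} {f : X ⟶ Y} {g : Y ⟶ Z} (hg : IsVertical p g)
    (hfg : IsVertical p (f ≫ g)) : IsVertical p f := by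
  have hfg' : p.IsHomLift (𝟙 (p.obj X)) (f ≫ g) := hfg
  have hg' : p.IsHomLift (𝟙 (p.obj Y)) g := hg
  have e₁ := lift_cod hfg'
  have e₂ := lift_cod hg'
  have h := IsHomLift.fac' p (𝟙 (p.obj X)) (f ≫ g)
  rw [p.map_comp, IsHomLift.fac' p (𝟙 (p.obj Y)) g] at h
  refine IsHomLift.of_fac' p _ f rfl (e₂.symm.trans e₁) ?_
  have h' := congrArg (fun k => k ≫ eqToHom e₂) h
  simpa using h'

/-- Sharing the carrier definitionally avoids transport when algebras are compared strictly, as an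
isomorphism of categories requires. -/
theorem PointedAlgebra.mk_eq {C : Type*} [Category* C] {T : C ⥤ C} {η : 𝟭 C ⟶ T}
    {X : PointedAlgebra T η} {t : T.obj X.carrier ⟶ X.carrier}
    (ht : η.app X.carrier ≫ t = 𝟙 X.carrier) (h : t = X.str) : ⟨X.carrier, t, ht⟩ = X := by
  obtain ⟨g, s, u⟩ := X
  dsimp only at t h
  subst h
  rfl

/-! ### Algebras over the pointed endofunctor, through their domain components -/

namespace FunctorialFactorisation

variable (W : FunctorialFactorisation p)

/-- The map `K f ⟶ K g` induced by a commutative square. -/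
def sq {f g : VertArrow p} (x : f.left ⟶ g.left) (y : f.right ⟶ g.right)
    (w : x ≫ g.hom = f.hom ≫ y) : W.K.obj f ⟶ W.K.obj g :=
  W.K.map (X := f) (Y := g) ⟨x, y, w⟩

section

variable {W} {f g h : VertArrow p}

theorem map_eq_sq (u : f ⟶ g) : W.K.map u = W.sq u.left u.right u.w := rfl

theorem sq_id (w : 𝟙 f.left ≫ f.hom = f.hom ≫ 𝟙 f.right) : W.sq (𝟙 f.left) (𝟙 f.right) w = 𝟙 _ :=
  W.K.map_id f

theorem sq_comp {x : f.left ⟶ g.left} {y : f.right ⟶ g.right} (w : x ≫ g.hom = f.hom ≫ y)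
    {x' : g.left ⟶ h.left} {y' : g.right ⟶ h.right} (w' : x' ≫ h.hom = g.hom ≫ y') :
    W.sq x y w ≫ W.sq x' y' w' = W.sq (x ≫ x') (y ≫ y')
      (by rw [Category.assoc, w', ← Category.assoc, w, Category.assoc]) :=
  (W.K.map_comp (X := f) (Y := g) (Z := h) ⟨x, y, w⟩ ⟨x', y', w'⟩).symm

theorem sq_comp_assoc {x : f.left ⟶ g.left} {y : f.right ⟶ g.right} (w : x ≫ g.hom = f.hom ≫ y)
    {x' : g.left ⟶ h.left} {y' : g.right ⟶ h.right} (w' : x' ≫ h.hom = g.hom ≫ y') {A : E}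
    (k : W.K.obj h ⟶ A) :
    W.sq x y w ≫ W.sq x' y' w' ≫ k = W.sq (x ≫ x') (y ≫ y')
      (by rw [Category.assoc, w', ← Category.assoc, w, Category.assoc]) ≫ k := by
  rw [← Category.assoc, sq_comp]

theorem sq_congr {x x' : f.left ⟶ g.left} {y y' : f.right ⟶ g.right} (hx : x = x') (hy : y = y')
    (w : x ≫ g.hom = f.hom ≫ y) : W.sq x y w = W.sq x' y' (by rw [← hx, ← hy, w]) := by
  subst hx hy; rfl

theorem l_sq {x : f.left ⟶ g.left} {y : f.right ⟶ g.right} (w : x ≫ g.hom = f.hom ≫ y) :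
    W.l.app f ≫ W.sq x y w = x ≫ W.l.app g :=
  (W.l.naturality (X := f) (Y := g) ⟨x, y, w⟩).symm

theorem sq_r {x : f.left ⟶ g.left} {y : f.right ⟶ g.right} (w : x ≫ g.hom = f.hom ≫ y) :
    W.sq x y w ≫ W.r.app g = W.r.app f ≫ y :=
  W.r.naturality (X := f) (Y := g) ⟨x, y, w⟩

end

/-- The structure on a vertical map of an algebra over the pointed endofunctor `R`, given by its
domain component. -/
@[ext]
structure Str (g : VertArrow p) where
  s : W.K.obj g ⟶ g.left
  l_s : W.l.app g ≫ s = 𝟙 g.left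
  s_hom : s ≫ g.hom = W.r.app g

variable {W}

/-- The pair `(x, y)` is a morphism of algebras over the pointed endofunctor `R`. -/
structure IsAlgHom {f g : VertArrow p} (a : W.Str f) (b : W.Str g) (x : f.left ⟶ g.left)
    (y : f.right ⟶ g.right) : Prop where
  w : x ≫ g.hom = f.hom ≫ y
  comm : W.sq x y w ≫ b.s = a.s ≫ x

theorem IsAlgHom.comp {f g h : VertArrow p} {a : W.Str f} {b : W.Str g} {c : W.Str h}
    {x : f.left ⟶ g.left} {y : f.right ⟶ g.right} {x' : g.left ⟶ h.left} {y' : g.right ⟶ h.right}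
    (m : IsAlgHom a b x y) (n : IsAlgHom b c x' y') : IsAlgHom a c (x ≫ x') (y ≫ y') where
  w := by rw [Category.assoc, n.w, ← Category.assoc, m.w, Category.assoc]
  comm := by
    rw [← sq_comp m.w n.w, Category.assoc, n.comm, ← Category.assoc, m.comm, Category.assoc]

theorem IsAlgHom.congr_right {f g : VertArrow p} {a : W.Str f} {b : W.Str g}
    {x : f.left ⟶ g.left} {y y' : f.right ⟶ g.right} (m : IsAlgHom a b x y) (h : y = y') :
    IsAlgHom a b x y' := by
  subst h; exact m

theorem IsAlgHom.id {f : VertArrow p} (a : W.Str f) : IsAlgHom a a (𝟙 _) (𝟙 _) where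
  w := by rw [Category.id_comp, Category.comp_id]
  comm := by rw [sq_id, Category.id_comp, Category.comp_id]

/-- The structure of an algebra over the pointed endofunctor `R`. -/
def ofRAlg (a : W.RAlg) : W.Str a.carrier where
  s := a.str.left
  l_s := congrArg VertArrow.Hom.left a.unit
  s_hom := by
    have h₁ : 𝟙 _ ≫ a.str.right = 𝟙 _ := congrArg VertArrow.Hom.right a.unit
    rw [Category.id_comp] at h₁
    exact a.str.w.trans ((congrArg (W.r.app a.carrier ≫ ·) h₁).trans (Category.comp_id _))

/-- The point of `R` has identity codomain component, so the unit law forces this one. Hence `Str`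
records only the domain component and loses nothing. -/
theorem RAlg_str_right (a : W.RAlg) : a.str.right = 𝟙 a.carrier.right :=
  (Category.id_comp _).symm.trans (congrArg VertArrow.Hom.right a.unit)

/-- The algebra over the pointed endofunctor `R` with the given structure. -/
@[simps carrier]
def Str.toRAlg {g : VertArrow p} (a : W.Str g) : W.RAlg where
  carrier := g
  str := ⟨a.s, 𝟙 _, a.s_hom.trans (Category.comp_id _).symm⟩
  unit := VertArrow.hom_ext a.l_s (Category.comp_id _)

theorem isAlgHom_of_hom {a b : W.RAlg} (u : a ⟶ b) :
    IsAlgHom (ofRAlg a) (ofRAlg b) u.hom.left u.hom.right where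
  w := u.hom.w
  comm := congrArg VertArrow.Hom.left u.comm

/-- A morphism of algebras, bundled. -/
@[simps]
def IsAlgHom.toHom {a b : W.RAlg} {x : a.carrier.left ⟶ b.carrier.left}
    {y : a.carrier.right ⟶ b.carrier.right} (m : IsAlgHom (ofRAlg a) (ofRAlg b) x y) :
    a ⟶ b where
  hom := ⟨x, y, m.w⟩
  comm := VertArrow.hom_ext m.comm (by
    change y ≫ b.str.right = a.str.right ≫ y
    rw [RAlg_str_right, RAlg_str_right, Category.id_comp, Category.comp_id])

/-! ### The comultiplication and composition of algebras -/

namespace Comult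

variable (c : W.Comult)

/-- The codomain component of the comultiplication. -/
def d (f : VertArrow p) : W.K.obj f ⟶ W.K.obj (W.L.obj f) := (c.δ.app f).right

theorem l_d (f : VertArrow p) : W.l.app f ≫ c.d f = W.l.app (W.L.obj f) := by
  have h := (c.δ.app f).w
  rw [c.left_δ] at h
  exact h.symm.trans (Category.id_comp _)

theorem d_r (f : VertArrow p) : c.d f ≫ W.r.app (W.L.obj f) = 𝟙 (W.K.obj f) :=
  congrArg VertArrow.Hom.right (c.left_counit f)

theorem counit_app_w (W : FunctorialFactorisation p) (f : VertArrow p) :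
    𝟙 f.left ≫ f.hom = W.l.app f ≫ W.r.app f := by
  rw [W.fac, Category.id_comp]

theorem d_sq (f : VertArrow p) :
    c.d f ≫ W.sq (f := W.L.obj f) (g := f) (𝟙 f.left) (W.r.app f) (counit_app_w W f) =
      𝟙 (W.K.obj f) :=
  congrArg VertArrow.Hom.right (c.right_counit f)

theorem δ_app_w (f : VertArrow p) :
    𝟙 f.left ≫ W.l.app (W.L.obj f) = W.l.app f ≫ c.d f := by
  rw [l_d, Category.id_comp]

theorem d_natural {f g : VertArrow p} {x : f.left ⟶ g.left} {y : f.right ⟶ g.right}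
    (w : x ≫ g.hom = f.hom ≫ y) :
    W.sq x y w ≫ c.d g = c.d f ≫ W.sq (f := W.L.obj f) (g := W.L.obj g) x (W.sq x y w)
      (l_sq w).symm :=
  congrArg VertArrow.Hom.right (c.δ.naturality (X := f) (Y := g) ⟨x, y, w⟩)

theorem d_coassoc (f : VertArrow p) :
    c.d f ≫ W.sq (f := W.L.obj f) (g := W.L.obj (W.L.obj f)) (𝟙 f.left) (c.d f) (c.δ_app_w f) =
      c.d f ≫ c.d (W.L.obj f) := by
  have h := congrArg VertArrow.Hom.right (c.coassoc f)
  refine (congrArg (c.d f ≫ ·) ?_).trans h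
  exact sq_congr (W := W) (f := W.L.obj f) (g := W.L.obj (W.L.obj f)) (c.left_δ f).symm rfl _

variable {X Y Z : E} {g : X ⟶ Y} {h : Y ⟶ Z} {f : X ⟶ Z} {hg : IsVertical p g}
  {hh : IsVertical p h}

/-- The bottom side of the square `L f ⟶ g` through which composite algebra structures are
defined. -/
def bot (hf : IsVertical p f) (w : g ≫ h = f) (b : W.Str ⟨Y, Z, h, hh⟩) :
    W.K.obj ⟨X, Z, f, hf⟩ ⟶ Y :=
  W.sq (f := ⟨X, Z, f, hf⟩) (g := ⟨Y, Z, h, hh⟩) g (𝟙 Z) (w.trans (Category.comp_id _).symm) ≫ b.s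

theorem bot_w {hf : IsVertical p f} (w : g ≫ h = f) (b : W.Str ⟨Y, Z, h, hh⟩) :
    𝟙 X ≫ g = W.l.app ⟨X, Z, f, hf⟩ ≫ bot hf w b := by
  rw [bot, ← Category.assoc, l_sq, Category.assoc, b.l_s]
  exact (Category.id_comp _).trans (Category.comp_id _).symm

theorem bot_hom {hf : IsVertical p f} (w : g ≫ h = f) (b : W.Str ⟨Y, Z, h, hh⟩) :
    bot hf w b ≫ h = W.r.app ⟨X, Z, f, hf⟩ := by
  have := b.s_hom
  dsimp only at this
  rw [bot, Category.assoc, this, sq_r]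
  exact Category.comp_id _

/-- The composite of two algebras over the pointed endofunctor `R` whose underlying vertical maps
are composable. -/
def compStr (hf : IsVertical p f) (w : g ≫ h = f) (a : W.Str ⟨X, Y, g, hg⟩)
    (b : W.Str ⟨Y, Z, h, hh⟩) : W.Str ⟨X, Z, f, hf⟩ where
  s := c.d _ ≫ W.sq (f := W.L.obj ⟨X, Z, f, hf⟩) (g := ⟨X, Y, g, hg⟩) (𝟙 X) (bot hf w b)
    (bot_w w b) ≫ a.s
  l_s := by
    rw [← Category.assoc, l_d, ← Category.assoc, l_sq, Category.assoc, a.l_s]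
    exact Category.comp_id _
  s_hom := by
    have h₁ := a.s_hom
    have h₂ := c.d_r ⟨X, Z, f, hf⟩
    subst w
    dsimp only at h₁ ⊢
    rw [Category.assoc, Category.assoc, ← Category.assoc a.s, h₁, ← Category.assoc _ _ h, sq_r,
      Category.assoc, bot_hom, ← Category.assoc, h₂, Category.id_comp]

/-- After `a.s`, the map `g` gives `R g`, which naturality turns into `R (L f)` followed by `bot`;
the counit law `d_r` then cancels the comultiplication. -/
theorem compStr_s_comp {hf : IsVertical p f} (w : g ≫ h = f) (a : W.Str ⟨X, Y, g, hg⟩)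
    (b : W.Str ⟨Y, Z, h, hh⟩) :
    (c.compStr hf w a b).s ≫ g = bot hf w b := by
  have h₁ := a.s_hom
  dsimp only at h₁
  rw [compStr, Category.assoc, Category.assoc, h₁, sq_r, ← Category.assoc, d_r, Category.id_comp]

/-- The lower map of the composite is a morphism from the composite. -/
theorem isAlgHom_compStr_right {hf : IsVertical p f} (w : g ≫ h = f) (a : W.Str ⟨X, Y, g, hg⟩)
    (b : W.Str ⟨Y, Z, h, hh⟩) : IsAlgHom (c.compStr hf w a b) b g (𝟙 Z) where
  w := w.trans (Category.comp_id _).symm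
  comm := (c.compStr_s_comp w a b).symm

/-- The reason is the right counit law `d_sq`. It lets a morphism out of the upper factor count as
one out of the composite, as soon as its codomain component factors through the lower map `h`. -/
theorem isAlgHom_compStr_left {hf : IsVertical p f} (w : g ≫ h = f) (a : W.Str ⟨X, Y, g, hg⟩)
    (b : W.Str ⟨Y, Z, h, hh⟩) {e : VertArrow p} (t : W.Str e) {x : X ⟶ e.left} {y : Z ⟶ e.right}
    (m : IsAlgHom a t x (h ≫ y)) : IsAlgHom (c.compStr hf w a b) t x y := by
  have hw : x ≫ e.hom = f ≫ y :=
    m.w.trans ((Category.assoc _ _ _).symm.trans (congrArg (· ≫ y) w))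
  refine ⟨hw, ?_⟩
  have h₁ := m.comm
  have h₂ := c.d_sq ⟨X, Z, f, hf⟩
  dsimp only at h₁
  change _ = (c.d _ ≫ W.sq _ _ _ ≫ a.s) ≫ x
  rw [Category.assoc, Category.assoc, ← h₁, sq_comp_assoc]
  -- Because `bot ≫ h` is `R f`, this square from `L f` factors through the counit square `L f ⟶ f`.
  have h₃ : W.sq (f := W.L.obj ⟨X, Z, f, hf⟩) (g := e) (𝟙 X ≫ x) (bot hf w b ≫ h ≫ y) (by
      change _ = W.l.app _ ≫ bot hf w b ≫ h ≫ y
      rw [Category.id_comp, ← Category.assoc (bot hf w b), bot_hom, ← Category.assoc, W.fac, hw]) =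
      W.sq (f := W.L.obj ⟨X, Z, f, hf⟩) (g := ⟨X, Z, f, hf⟩) (𝟙 X) (W.r.app _)
        (counit_app_w W ⟨X, Z, f, hf⟩) ≫ W.sq (f := ⟨X, Z, f, hf⟩) (g := e) x y hw := by
    rw [sq_comp]
    exact sq_congr rfl (by rw [← Category.assoc, bot_hom]) _
  rw [h₃, Category.assoc, ← Category.assoc, h₂, Category.id_comp]

/-- Composition of algebras is functorial: `n` makes the lower edges `bot` compatible, and
naturality of the comultiplication together with `m` does the rest. -/
theorem isAlgHom_compStr {X' Y' Z' : E} {g' : X' ⟶ Y'} {h' : Y' ⟶ Z'} {f' : X' ⟶ Z'}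
    {hf : IsVertical p f} {hg' : IsVertical p g'} {hh' : IsVertical p h'} {hf' : IsVertical p f'}
    (w : g ≫ h = f) (w' : g' ≫ h' = f') {a : W.Str ⟨X, Y, g, hg⟩} {b : W.Str ⟨Y, Z, h, hh⟩}
    {a' : W.Str ⟨X', Y', g', hg'⟩} {b' : W.Str ⟨Y', Z', h', hh'⟩} {x : X ⟶ X'} {y : Y ⟶ Y'}
    {z : Z ⟶ Z'} (m : IsAlgHom a a' x y) (n : IsAlgHom b b' y z) :
    IsAlgHom (c.compStr hf w a b) (c.compStr hf' w' a' b') x z := by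
  have h₁ : x ≫ g' = g ≫ y := m.w
  have h₂ : y ≫ h' = h ≫ z := n.w
  have h₃ : x ≫ f' = f ≫ z := by
    rw [← w, ← w', Category.assoc, ← h₂, ← Category.assoc, h₁, Category.assoc]
  refine ⟨h₃, ?_⟩
  have h₄ : W.sq (f := ⟨X, Z, f, hf⟩) (g := ⟨X', Z', f', hf'⟩) x z h₃ ≫ bot hf' w' b' =
      bot hf w b ≫ y := by
    have hn : _ = b.s ≫ y := n.comm
    rw [bot, bot, Category.assoc, ← hn, sq_comp_assoc, sq_comp_assoc]
    exact congrArg (· ≫ b'.s) (sq_congr h₁ ((Category.comp_id _).trans (Category.id_comp _).symm) _)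
  have hm : _ = a.s ≫ x := m.comm
  change _ = _ ≫ x
  rw [compStr, compStr, ← Category.assoc, d_natural, Category.assoc, Category.assoc,
    Category.assoc, ← hm, sq_comp_assoc, sq_comp_assoc]
  exact congrArg (fun k => c.d _ ≫ k ≫ a'.s)
    (sq_congr ((Category.comp_id _).trans (Category.id_comp _).symm) h₄ _)

/-- Coassociativity of the comultiplication, read through algebras. The equations `w`, `w₁`, `w₂`,
`w₃` are kept separate so that both bracketings are structures on one and the same vertical map `v`.
-/
theorem compStr_assoc {Z' : E} {k : Z ⟶ Z'} {hk : IsVertical p k} {u : Y ⟶ Z'} {v : X ⟶ Z'}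
    {hf : IsVertical p f} {hu : IsVertical p u} {hv : IsVertical p v}
    (w : g ≫ h = f) (w₁ : h ≫ k = u) (w₂ : g ≫ u = v)
    (w₃ : f ≫ k = v) (a : W.Str ⟨X, Y, g, hg⟩) (b : W.Str ⟨Y, Z, h, hh⟩)
    (e : W.Str ⟨Z, Z', k, hk⟩) :
    c.compStr hv w₃ (c.compStr hf w a b) e = c.compStr hv w₂ a (c.compStr hu w₁ b e) := by
  -- Naturality of the comultiplication along the square `(g, 𝟙)` from `v` to `u` computes the lower
  -- edge of the right-bracketed composite.
  have h₁ : bot hv w₂ (c.compStr hu w₁ b e) = c.d _ ≫ W.sq (f := W.L.obj ⟨X, Z', v, hv⟩)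
      (g := ⟨X, Z, f, hf⟩) (𝟙 X) (bot hv w₃ e) (bot_w w₃ e) ≫ bot hf w b := by
    change W.sq _ _ _ ≫ c.d _ ≫ W.sq _ _ _ ≫ b.s = c.d _ ≫ W.sq _ _ _ ≫ W.sq _ _ _ ≫ b.s
    rw [← Category.assoc, d_natural, Category.assoc, sq_comp_assoc,
      sq_comp_assoc]
    refine congrArg (fun k => c.d _ ≫ k ≫ b.s)
      (sq_congr ((Category.comp_id _).trans (Category.id_comp _).symm) ?_ _)
    rw [bot, bot, sq_comp_assoc]
    refine Eq.trans (congrArg (· ≫ e.s) (sq_congr w ?_ _)) (Category.comp_id _).symm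
    exact Category.comp_id _
  ext
  change c.d _ ≫ W.sq _ _ (bot_w w₃ e) ≫ c.d _ ≫ W.sq _ _ _ ≫ a.s = c.d _ ≫ W.sq _ _ _ ≫ a.s
  rw [← Category.assoc (W.sq _ _ (bot_w w₃ e)), d_natural, Category.assoc, ← Category.assoc (c.d _)]
  refine (congrArg (· ≫ _) (c.d_coassoc ⟨X, Z', v, hv⟩).symm).trans ?_
  rw [Category.assoc, sq_comp_assoc, sq_comp_assoc]
  exact congrArg (fun k => c.d _ ≫ k ≫ a.s)
    (sq_congr (by rw [Category.comp_id, Category.comp_id]) ((Category.assoc _ _ _).trans h₁.symm) _)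

end Comult

end FunctorialFactorisation

/-! ### Free algebras with respect to arbitrary squares -/

namespace FunctorialFactorisation

/-- A free algebra on `f` over the pointed endofunctor `R`, whose unit has identity codomain
component `l`. -/
structure Free (W : FunctorialFactorisation p) (f : VertArrow p) where
  K : E
  l : f.left ⟶ K
  r : K ⟶ f.right
  vertical_r : IsVertical p r
  fac : l ≫ r = f.hom
  str : W.Str ⟨K, f.right, r, vertical_r⟩
  univ : ∀ {g : VertArrow p} (b : W.Str g) (x : f.left ⟶ g.left) (y : f.right ⟶ g.right),
    x ≫ g.hom = f.hom ≫ y → ∃! k : K ⟶ g.left, l ≫ k = x ∧ IsAlgHom str b k y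

namespace Free

variable {W : FunctorialFactorisation p} {f g : VertArrow p} (F : W.Free f)

theorem vertical_l : IsVertical p F.l :=
  IsVertical.of_comp F.vertical_r (by rw [F.fac]; exact f.vertical)

/-- The underlying vertical map of a free algebra. -/
abbrev obj : VertArrow p := ⟨F.K, f.right, F.r, F.vertical_r⟩

theorem unit_w : F.l ≫ F.r = f.hom ≫ 𝟙 f.right := F.fac.trans (Category.comp_id _).symm

/-- The unit of a free algebra. -/
@[simps]
def unit : f ⟶ F.obj := ⟨F.l, 𝟙 _, F.unit_w⟩

/-- The morphism from a free algebra given by its universal property. -/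
def desc (b : W.Str g) (x : f.left ⟶ g.left) (y : f.right ⟶ g.right)
    (w : x ≫ g.hom = f.hom ≫ y) : F.K ⟶ g.left :=
  (F.univ b x y w).choose

variable (b : W.Str g) (x : f.left ⟶ g.left) (y : f.right ⟶ g.right)
    (w : x ≫ g.hom = f.hom ≫ y)

theorem l_desc : F.l ≫ F.desc b x y w = x := (F.univ b x y w).choose_spec.1.1

theorem isAlgHom_desc : IsAlgHom F.str b (F.desc b x y w) y := (F.univ b x y w).choose_spec.1.2

variable {y}

/-- The codomain components are allowed to be only propositionally equal, since the composites to be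
compared lie over maps such as `𝟙 _ ≫ y` and `y ≫ 𝟙 _`. -/
theorem hom_ext {y' : f.right ⟶ g.right} {k k' : F.K ⟶ g.left} (h : IsAlgHom F.str b k y)
    (h' : IsAlgHom F.str b k' y') (hy : y = y') (e : F.l ≫ k = F.l ≫ k') : k = k' := by
  subst hy
  have hw : k' ≫ g.hom = F.r ≫ y := h'.w
  refine (F.univ b (F.l ≫ k') y ?_).unique ⟨e, h⟩ ⟨rfl, h'⟩
  rw [Category.assoc, hw, ← Category.assoc, F.fac]

end Free

end FunctorialFactorisation

open FunctorialFactorisation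

/-! ### The factorisation and the monad of free algebras -/

namespace FreeAwfs

variable {W : FunctorialFactorisation p} (F : ∀ f, W.Free f)

/-- The action of the free algebra functor on a square. -/
def map {f g : VertArrow p} (u : f ⟶ g) : (F f).K ⟶ (F g).K :=
  (F f).desc (F g).str (u.left ≫ (F g).l) u.right (by
    rw [Category.assoc, (F g).fac, u.w])

theorem l_map {f g : VertArrow p} (u : f ⟶ g) : (F f).l ≫ map F u = u.left ≫ (F g).l :=
  (F f).l_desc _ _ _ _

theorem isAlgHom_map {f g : VertArrow p} (u : f ⟶ g) :
    IsAlgHom (F f).str (F g).str (map F u) u.right :=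
  (F f).isAlgHom_desc _ _ _ _

/-- This sets the pattern for the monad and comonad laws: exhibit both sides as algebra morphisms
out of a free algebra, over equal codomain maps, and compare them on the unit. -/
theorem map_id (f : VertArrow p) : map F (𝟙 f) = 𝟙 _ :=
  (F f).hom_ext (F f).str (isAlgHom_map F _) (IsAlgHom.id _) rfl (by
    rw [l_map, VertArrow.id_left, Category.id_comp, Category.comp_id])

theorem map_comp {f g h : VertArrow p} (a : f ⟶ g) (b : g ⟶ h) :
    map F (a ≫ b) = map F a ≫ map F b :=
  (F f).hom_ext (F h).str (isAlgHom_map F _) ((isAlgHom_map F a).comp (isAlgHom_map F b)) rfl (by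
    rw [l_map, VertArrow.comp_left, ← Category.assoc, l_map, Category.assoc, Category.assoc,
      l_map])

/-- The functorial factorisation given by free algebras. -/
@[simps]
def factorisation : FunctorialFactorisation p where
  K :=
    { obj f := (F f).K
      map u := map F u
      map_id := map_id F
      map_comp := map_comp F }
  l :=
    { app f := (F f).l
      naturality _ _ u := (l_map F u).symm }
  r :=
    { app f := (F f).r
      naturality _ _ u := (isAlgHom_map F u).w }
  vertical_l f := (F f).vertical_l
  vertical_r f := (F f).vertical_r
  fac f := (F f).fac

/-- The right map of the factorisation of a square. -/
@[simps]
def mapR {f g : VertArrow p} (u : f ⟶ g) : (F f).obj ⟶ (F g).obj :=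
  ⟨map F u, u.right, (isAlgHom_map F u).w⟩

/-- The domain component of the multiplication of the free algebra monad. -/
def mul (f : VertArrow p) : (F (F f).obj).K ⟶ (F f).K :=
  (F (F f).obj).desc (F f).str (𝟙 _) (𝟙 _) ((Category.id_comp _).trans (Category.comp_id _).symm)

theorem l_mul (f : VertArrow p) : (F (F f).obj).l ≫ mul F f = 𝟙 _ :=
  (F (F f).obj).l_desc _ _ _ _

theorem isAlgHom_mul (f : VertArrow p) :
    IsAlgHom (F (F f).obj).str (F f).str (mul F f) (𝟙 _) :=
  (F (F f).obj).isAlgHom_desc _ _ _ _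

/-- The multiplication of the free algebra monad. -/
@[simps]
def mulSq (f : VertArrow p) : (F (F f).obj).obj ⟶ (F f).obj :=
  ⟨mul F f, 𝟙 _, (isAlgHom_mul F f).w⟩

theorem map_mul {f g : VertArrow p} (u : f ⟶ g) :
    map F (mapR F u) ≫ mul F g = mul F f ≫ map F u :=
  (F (F f).obj).hom_ext (F g).str ((isAlgHom_map F (mapR F u)).comp (isAlgHom_mul F g))
    ((isAlgHom_mul F f).comp (isAlgHom_map F u))
    ((Category.comp_id _).trans (Category.id_comp _).symm) (by
      rw [← Category.assoc, l_map, Category.assoc, l_mul, ← Category.assoc, l_mul, Category.comp_id,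
        Category.id_comp, mapR_left])

theorem map_unit_mul (f : VertArrow p) : map F (F f).unit ≫ mul F f = 𝟙 _ :=
  (F f).hom_ext (F f).str ((isAlgHom_map F (F f).unit).comp (isAlgHom_mul F f)) (IsAlgHom.id _)
    (Category.comp_id _) (by
      rw [← Category.assoc, l_map, Category.assoc, l_mul, Free.unit_left])

theorem mul_assoc (f : VertArrow p) : map F (mulSq F f) ≫ mul F f = mul F (F f).obj ≫ mul F f :=
  (F (F (F f).obj).obj).hom_ext (F f).str ((isAlgHom_map F (mulSq F f)).comp (isAlgHom_mul F f))
    ((isAlgHom_mul F (F f).obj).comp (isAlgHom_mul F f)) rfl (by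
      rw [← Category.assoc, l_map, Category.assoc, l_mul, ← Category.assoc, l_mul, Category.comp_id,
        Category.id_comp, mulSq_left])

/-- The multiplication making the right part of the factorisation a monad. -/
def mult : (factorisation F).Mult where
  μ :=
    { app f := mulSq F f
      naturality _ _ u := VertArrow.hom_ext (map_mul F u)
        ((Category.comp_id _).trans (Category.id_comp _).symm) }
  right_μ _ := rfl
  left_unit f := VertArrow.hom_ext (l_mul F f) (Category.comp_id _)
  right_unit f := VertArrow.hom_ext (map_unit_mul F f) (Category.comp_id _)
  assoc f := VertArrow.hom_ext (mul_assoc F f) rfl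

/-- The left part of the factorisation. -/
abbrev left (f : VertArrow p) : VertArrow p := ⟨f.left, (F f).K, (F f).l, (F f).vertical_l⟩

/-! ### The comultiplication and the distributive law -/

section Comult

variable (c : W.Comult)

theorem isVertical_comp (f : VertArrow p) : IsVertical p ((F (left F f)).r ≫ (F f).r) :=
  (F (left F f)).vertical_r.comp (F f).vertical_r

/-- The composite of the free algebras on `L f` and on `f`. -/
def compFree (f : VertArrow p) :
    W.Str ⟨(F (left F f)).K, f.right, (F (left F f)).r ≫ (F f).r, isVertical_comp F f⟩ :=
  c.compStr _ rfl (F (left F f)).str (F f).str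

/-- The codomain component of the comultiplication. -/
def comul (f : VertArrow p) : (F f).K ⟶ (F (left F f)).K :=
  (F f).desc (compFree F c f) (F (left F f)).l (𝟙 _) (by
    have : (F (left F f)).l ≫ (F (left F f)).r = (F f).l := (F (left F f)).fac
    change (F (left F f)).l ≫ (F (left F f)).r ≫ (F f).r = _
    rw [← Category.assoc, this, (F f).fac, Category.comp_id])

theorem l_comul (f : VertArrow p) : (F f).l ≫ comul F c f = (F (left F f)).l :=
  (F f).l_desc _ _ _ _

theorem isAlgHom_comul (f : VertArrow p) :
    IsAlgHom (F f).str (compFree F c f) (comul F c f) (𝟙 _) :=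
  (F f).isAlgHom_desc _ _ _ _

/-- The left map of the factorisation of a square. -/
@[simps]
def mapL {f g : VertArrow p} (u : f ⟶ g) : left F f ⟶ left F g :=
  ⟨u.left, map F u, (l_map F u).symm⟩

theorem isAlgHom_map_compFree {f g : VertArrow p} (u : f ⟶ g) :
    IsAlgHom (compFree F c f) (compFree F c g) (map F (mapL F u)) u.right :=
  c.isAlgHom_compStr rfl rfl (isAlgHom_map F (mapL F u)) (isAlgHom_map F u)

theorem map_comul {f g : VertArrow p} (u : f ⟶ g) :
    map F u ≫ comul F c g = comul F c f ≫ map F (mapL F u) :=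
  (F f).hom_ext (compFree F c g) ((isAlgHom_map F u).comp (isAlgHom_comul F c g))
    ((isAlgHom_comul F c f).comp (isAlgHom_map_compFree F c u))
    ((Category.comp_id _).trans (Category.id_comp _).symm) (by
      rw [← Category.assoc, l_map, Category.assoc, l_comul, ← Category.assoc, l_comul, l_map,
        mapL_left])

/-- The lower free algebra receives a morphism from the composite, so this is an algebra
endomorphism of `F f` fixing the unit. -/
theorem comul_r (f : VertArrow p) : comul F c f ≫ (F (left F f)).r = 𝟙 _ :=
  (F f).hom_ext (F f).str
    ((isAlgHom_comul F c f).comp (c.isAlgHom_compStr_right rfl _ _)) (IsAlgHom.id _)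
    (Category.comp_id _) (by
      have : (F (left F f)).l ≫ (F (left F f)).r = (F f).l := (F (left F f)).fac
      rw [← Category.assoc, l_comul, this, Category.comp_id])

/-- The comultiplication. -/
@[simps]
def comulSq (f : VertArrow p) : left F f ⟶ left F (left F f) :=
  ⟨𝟙 _, comul F c f, (Category.id_comp _).trans (l_comul F c f).symm⟩

/-- The counit of the left part. -/
@[simps]
def counit (f : VertArrow p) : left F f ⟶ f :=
  ⟨𝟙 _, (F f).r, (Category.id_comp _).trans (F f).fac.symm⟩

theorem comul_map_counit (f : VertArrow p) : comul F c f ≫ map F (counit F f) = 𝟙 _ := by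
  have h : IsAlgHom (compFree F c f) (F f).str (map F (counit F f)) (𝟙 _) := by
    refine c.isAlgHom_compStr_left rfl _ _ _ ?_
    have := isAlgHom_map F (counit F f)
    -- The morphism lies over `(F f).r`; written as `(F f).r ≫ 𝟙 _` it has the form needed to
    -- descend to the composite.
    exact (Category.comp_id (F f).r).symm ▸ this
  refine (F f).hom_ext (F f).str ((isAlgHom_comul F c f).comp h) (IsAlgHom.id _)
    (Category.comp_id _) ?_
  rw [← Category.assoc, l_comul, l_map, counit_left, Category.comp_id]
  exact Category.id_comp _

/-- The two sides are algebra morphisms into the two bracketings of a threefold composite of free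
algebras; `compStr_assoc` identifies their targets, after which freeness applies. -/
theorem comul_coassoc (f : VertArrow p) :
    comul F c f ≫ map F (comulSq F c f) = comul F c f ≫ comul F c (left F f) := by
  have hv : IsVertical p ((F (left F (left F f))).r ≫ (F (left F f)).r ≫ (F f).r) :=
    (F (left F (left F f))).vertical_r.comp (isVertical_comp F f)
  have h₁ : IsAlgHom (compFree F c f) (c.compStr hv rfl _ _) _ _ :=
    c.isAlgHom_compStr rfl rfl (isAlgHom_map F (comulSq F c f)) (isAlgHom_comul F c f)
  have h₂ : IsAlgHom (compFree F c f) (c.compStr hv (Category.assoc _ _ _) _ _) _ _ :=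
    c.isAlgHom_compStr rfl (Category.assoc _ _ _) (isAlgHom_comul F c (left F f))
      (IsAlgHom.id (F f).str)
  have h₃ := (isAlgHom_comul F c f).comp h₁
  have h₄ := (isAlgHom_comul F c f).comp h₂
  refine (F f).hom_ext (c.compStr hv rfl (F (left F (left F f))).str (compFree F c f)) h₃
    (y' := 𝟙 f.right ≫ 𝟙 f.right) ?_ rfl ?_
  · have e := c.compStr_assoc (hf := isVertical_comp F (left F f)) (hu := isVertical_comp F f)
      (hv := hv) rfl rfl rfl (Category.assoc _ _ _)
      (F (left F (left F f))).str (F (left F f)).str (F f).str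
    exact e ▸ h₄
  · change (F f).l ≫ comul F c f ≫ map F (comulSq F c f) =
      (F f).l ≫ comul F c f ≫ comul F c (left F f)
    rw [← Category.assoc, l_comul, l_map, ← Category.assoc, l_comul, l_comul]
    exact Category.id_comp _

/-- The comultiplication making the left part of the factorisation a comonad. -/
def comult : (factorisation F).Comult where
  δ :=
    { app f := comulSq F c f
      naturality _ _ u := VertArrow.hom_ext ((Category.comp_id _).trans (Category.id_comp _).symm)
        (map_comul F c u) }
  left_δ _ := rfl
  left_counit f := VertArrow.hom_ext (Category.comp_id _) (comul_r F c f)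
  right_counit f := VertArrow.hom_ext (Category.comp_id _) (comul_map_counit F c f)
  coassoc f := VertArrow.hom_ext rfl (comul_coassoc F c f)

/-- The component of the distributive law. -/
@[simps]
def distSq (f : VertArrow p) : left F (F f).obj ⟶ (F (left F f)).obj :=
  ⟨comul F c f, mul F f, (comul_r F c f).trans (l_mul F f).symm⟩

/-- Both sides are algebra morphisms from the free algebra on `R f` to `compFree F c f`; for the
right-hand side, `map` of `distSq` and `mul` are composed factorwise with `mul F f` on the lower
factor. -/
theorem mul_comul (f : VertArrow p) :
    mul F f ≫ comul F c f =
      comul F c (F f).obj ≫ map F (distSq F c f) ≫ mul F (left F f) := by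
  have h : IsAlgHom (compFree F c (F f).obj) (compFree F c f) _ _ := c.isAlgHom_compStr rfl rfl
    ((isAlgHom_map F (distSq F c f)).comp (isAlgHom_mul F (left F f)))
    ((Category.comp_id (mul F f)).symm ▸ isAlgHom_mul F f)
  refine (F (F f).obj).hom_ext (compFree F c f) ((isAlgHom_mul F f).comp (isAlgHom_comul F c f))
    ((isAlgHom_comul F c (F f).obj).comp h) rfl ?_
  rw [← Category.assoc, l_mul, ← Category.assoc, l_comul, ← Category.assoc, l_map, Category.assoc,
    l_mul, distSq_left, Category.comp_id]
  exact Category.id_comp _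

/-- The awfs given by free algebras. -/
def awfs : Awfs p where
  fact := factorisation F
  comult := comult F c
  mult := mult F
  distrib :=
    -- Each axiom splits into a domain and a codomain component. The hexagon `mul_comul` occurs
    -- twice: as the domain part of `mul` and as the codomain part of `comul`. The other components
    -- restate monad and comonad laws or the defining triangles.
    { unit f := VertArrow.hom_ext (l_comul F c f) (map_unit_mul F f)
      mul f := VertArrow.hom_ext (mul_comul F c f)
        ((mul_assoc F f).trans (congrArg (_ ≫ ·) (Category.comp_id _).symm))
      counit f := VertArrow.hom_ext (comul_map_counit F c f)
        ((isAlgHom_mul F f).w.trans (Category.comp_id _))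
      comul f := VertArrow.hom_ext ((comul_coassoc F c f).trans (Category.id_comp _).symm)
        (mul_comul F c f) }

end Comult

/-! ### The morphism of lawfs's into the free awfs -/

/-- The comparison from the given factorisation to the one given by free algebras. -/
def ξ (f : VertArrow p) : W.K.obj f ⟶ (F f).K :=
  W.sq (f := f) (g := (F f).obj) (F f).l (𝟙 _) (F f).unit_w ≫ (F f).str.s

theorem ξ_natural {f g : VertArrow p} (u : f ⟶ g) : W.K.map u ≫ ξ F g = ξ F f ≫ map F u := by
  rw [ξ, ξ, Category.assoc, map_eq_sq, sq_comp_assoc]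
  refine Eq.trans ?_ (congrArg (W.sq (f := f) (g := (F f).obj) _ _ _ ≫ ·) (isAlgHom_map F u).comm)
  rw [sq_comp_assoc]
  exact congrArg (· ≫ (F g).str.s)
    (sq_congr (l_map F u).symm ((Category.comp_id _).trans (Category.id_comp _).symm) _)

theorem l_ξ (f : VertArrow p) : W.l.app f ≫ ξ F f = (F f).l := by
  have h := (F f).str.l_s
  rw [ξ, ← Category.assoc, l_sq, Category.assoc, h]
  exact Category.comp_id _

theorem ξ_r (f : VertArrow p) : ξ F f ≫ (F f).r = W.r.app f := by
  have h : _ ≫ (F f).r = _ := (F f).str.s_hom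
  rw [ξ, Category.assoc, h, sq_r]
  exact Category.comp_id _

/-- The comparison as a morphism of functorial factorisations. -/
@[simps]
def comparison : W.Hom (factorisation F) where
  ξ :=
    { app f := ξ F f
      naturality _ _ u := ξ_natural F u }
  l_ξ := l_ξ F
  ξ_r := ξ_r F

/-- The comparison is compatible with morphisms of algebras. -/
theorem ξ_comp {f g : VertArrow p} (b : W.Str g) {k : (F f).K ⟶ g.left} {y : f.right ⟶ g.right}
    (h : IsAlgHom (F f).str b k y) (w : ((F f).l ≫ k) ≫ g.hom = f.hom ≫ y) :
    ξ F f ≫ k = W.sq (f := f) (g := g) ((F f).l ≫ k) y w ≫ b.s := by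
  rw [ξ, Category.assoc]
  refine (congrArg (W.sq (f := f) (g := (F f).obj) _ _ _ ≫ ·) h.comm.symm).trans ?_
  rw [sq_comp_assoc]
  exact congrArg (· ≫ b.s) (sq_congr rfl (Category.id_comp _) _)

/-- By `ξ_comp`, the left side is governed by the structure of `compFree`, which unfolds to the
comultiplication of `W` followed by two free structures. The lower of these is absorbed into `ξ F
f`, the upper into `ξ F (left F f)`. -/
theorem ξ_comul (c : W.Comult) (f : VertArrow p) :
    ξ F f ≫ comul F c f =
      c.d f ≫ W.sq (f := W.L.obj f) (g := left F f) (𝟙 f.left) (ξ F f)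
        ((Category.id_comp _).trans (l_ξ F f).symm) ≫ ξ F (left F f) := by
  have w : (F (left F f)).l ≫ (F (left F f)).r ≫ (F f).r = f.hom := by
    have : (F (left F f)).l ≫ (F (left F f)).r = (F f).l := (F (left F f)).fac
    rw [← Category.assoc, this, (F f).fac]
  rw [ξ_comp F _ (isAlgHom_comul F c f) (by
    rw [l_comul]; exact w.trans (Category.comp_id _).symm)]
  change W.sq _ _ _ ≫ c.d _ ≫ W.sq _ _ _ ≫ (F (left F f)).str.s = _
  rw [← Category.assoc, Comult.d_natural, Category.assoc, sq_comp_assoc]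
  change _ = c.d f ≫ W.sq _ _ _ ≫ W.sq (f := left F f) (g := (F (left F f)).obj) _ _
    (F (left F f)).unit_w ≫ (F (left F f)).str.s
  rw [sq_comp_assoc]
  refine congrArg (fun k => c.d f ≫ k ≫ (F (left F f)).str.s) (sq_congr ?_ ?_ _)
  · rw [l_comul]
    exact (Category.comp_id _).trans (Category.id_comp _).symm
  · rw [Comult.bot, ξ, sq_comp_assoc]
    refine Eq.trans (congrArg (· ≫ (F f).str.s) (sq_congr ?_ ?_ _)) (Category.comp_id _).symm
    · rw [l_comul]
      exact (F (left F f)).fac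
    · exact Category.comp_id _

/-- The comparison as a morphism of lawfs's. -/
def lawfsHom (c : W.Comult) : Lawfs.Hom ⟨W, c⟩ (awfs F c).toLawfs where
  toHom := comparison F
  comult_comm f := VertArrow.hom_ext (by
    change 𝟙 _ ≫ 𝟙 _ = (c.δ.app f).left ≫ 𝟙 _ ≫ 𝟙 _
    rw [c.left_δ]
    exact (Category.id_comp _).symm) (ξ_comul F c f)

/-! ### Monad algebras are algebras over the pointed endofunctor -/

/-- The free extension of the identity along the unit of the free algebra. -/
def ext {g : VertArrow p} (a : W.Str g) : (F g).K ⟶ g.left :=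
  (F g).desc a (𝟙 _) (𝟙 _) ((Category.id_comp _).trans (Category.comp_id _).symm)

theorem l_ext {g : VertArrow p} (a : W.Str g) : (F g).l ≫ ext F a = 𝟙 _ :=
  (F g).l_desc _ _ _ _

theorem isAlgHom_ext {g : VertArrow p} (a : W.Str g) : IsAlgHom (F g).str a (ext F a) (𝟙 _) :=
  (F g).isAlgHom_desc _ _ _ _

/-- Restricting the extension along the comparison recovers the original structure; this gives one
of the two inverse laws on objects. -/
theorem ξ_ext {g : VertArrow p} (a : W.Str g) : ξ F g ≫ ext F a = a.s := by
  rw [ξ_comp F a (isAlgHom_ext F a) (by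
    rw [l_ext, Category.id_comp]; exact (Category.comp_id _).symm)]
  rw [sq_congr (l_ext F a) rfl, sq_id, Category.id_comp]

/-- The structure of an algebra over the free algebra monad, from an algebra over the pointed
endofunctor. -/
def toAlgebra {g : VertArrow p} (a : W.Str g) : (mult F).monad.Algebra where
  A := g
  a := ⟨ext F a, 𝟙 _, (isAlgHom_ext F a).w⟩
  unit := VertArrow.hom_ext (l_ext F a) (Category.comp_id _)
  assoc := VertArrow.hom_ext (by
    refine (F (F g).obj).hom_ext a ((isAlgHom_mul F g).comp (isAlgHom_ext F a))
      ((isAlgHom_map F (⟨ext F a, 𝟙 _, (isAlgHom_ext F a).w⟩ : (F g).obj ⟶ g)).comp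
        (isAlgHom_ext F a)) rfl ?_
    change (F (F g).obj).l ≫ mul F g ≫ ext F a =
      (F (F g).obj).l ≫ map F (⟨ext F a, 𝟙 _, (isAlgHom_ext F a).w⟩ : (F g).obj ⟶ g) ≫ ext F a
    rw [← Category.assoc, l_mul, ← Category.assoc, l_map, Category.assoc, l_ext, Category.id_comp]
    exact (Category.comp_id _).symm) rfl

/-- The structure map of an algebra over the free algebra monad is a morphism of algebras over the
pointed endofunctor. -/
theorem isAlgHom_of_assoc {g : VertArrow p} (t : (F g).obj ⟶ g) (hr : t.right = 𝟙 _)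
    (ha : mul F g ≫ t.left = map F t ≫ t.left) (b : W.Str g) (hb : b.s = ξ F g ≫ t.left) :
    IsAlgHom (F g).str b t.left (𝟙 _) := by
  have hw : t.left ≫ g.hom = (F g).obj.hom ≫ 𝟙 _ := by rw [t.w, hr]
  refine ⟨hw, ?_⟩
  have h₁ : W.sq t.left (𝟙 _) hw ≫ ξ F g = ξ F (F g).obj ≫ map F t := by
    rw [← ξ_natural, map_eq_sq, sq_congr rfl hr]
  -- The free structure itself is recovered from the monad multiplication; associativity of `t` then
  -- carries this over to `g`.
  have h₃ : ξ F (F g).obj ≫ mul F g = (F g).str.s := by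
    rw [ξ_comp F _ (isAlgHom_mul F g) (by
      rw [l_mul, Category.id_comp]; exact (Category.comp_id _).symm)]
    rw [sq_congr (l_mul F g) rfl]
    exact (congrArg (· ≫ (F g).str.s) (sq_id _)).trans (Category.id_comp _)
  rw [hb, ← Category.assoc, h₁, Category.assoc, ← ha, ← Category.assoc, h₃]

/-- The functor from algebras over the free algebra monad to algebras over the pointed endofunctor
`R`. -/
abbrev algebraComparison : (mult F).monad.Algebra ⥤ W.RAlg :=
  (mult F).forget ⋙ (comparison F).algebraFunctor

theorem isAlgHom_algebraComparison (a : (mult F).monad.Algebra) :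
    IsAlgHom (F a.A).str (ofRAlg ((algebraComparison F).obj a)) a.a.left (𝟙 _) :=
  isAlgHom_of_assoc F (g := a.A) a.a
    ((Category.id_comp _).symm.trans (congrArg VertArrow.Hom.right a.unit))
    (congrArg VertArrow.Hom.left a.assoc) _ rfl

/-- Both are algebra morphisms from the free algebra that restrict to the identity, so a monad
structure is determined by its restriction. -/
theorem a_left_eq_ext (a : (mult F).monad.Algebra) :
    a.a.left = ext F (ofRAlg ((algebraComparison F).obj a)) :=
  (F a.A).hom_ext (ofRAlg ((algebraComparison F).obj a)) (isAlgHom_algebraComparison F a)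
    (isAlgHom_ext F _) rfl
    ((congrArg VertArrow.Hom.left a.unit).trans (l_ext F _).symm)

theorem toAlgebra_algebraComparison (a : (mult F).monad.Algebra) :
    toAlgebra F (ofRAlg ((algebraComparison F).obj a)) = a := by
  have hr : a.a.right = 𝟙 _ := (Category.id_comp _).symm.trans (congrArg VertArrow.Hom.right a.unit)
  have h : (toAlgebra F (ofRAlg ((algebraComparison F).obj a))).a = a.a :=
    VertArrow.hom_ext (a_left_eq_ext F a).symm hr.symm
  have key : ∀ (b : (mult F).monad.Algebra) (t : (mult F).monad.obj b.A ⟶ b.A) (h₁ h₂),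
      t = b.a → (⟨b.A, t, h₁, h₂⟩ : (mult F).monad.Algebra) = b := by
    rintro ⟨g, s, u, v⟩ t h₁ h₂ e
    dsimp only at t e
    subst e
    rfl
  exact key a _ _ _ h

theorem algebraComparison_toAlgebra (a : W.RAlg) :
    (algebraComparison F).obj (toAlgebra F (ofRAlg a)) = a :=
  PointedAlgebra.mk_eq _ (VertArrow.hom_ext (ξ_ext F (ofRAlg a))
    ((Category.comp_id _).trans (RAlg_str_right a).symm))

instance : (algebraComparison F).IsIso where
  faithful := ⟨fun {a b} u v h => Monad.Algebra.Hom.ext (congrArg PointedAlgebra.Hom.hom h)⟩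
  full := ⟨fun {a b} u => by
    have hu := isAlgHom_of_hom u
    -- Fullness: an `R`-algebra morphism commutes with the monad structures because both paths are
    -- algebra morphisms out of `F a.A` that restrict to `u` on the unit.
    have h₁ : a.a.left ≫ u.hom.left = map F u.hom ≫ b.a.left :=
      (F a.A).hom_ext (ofRAlg ((algebraComparison F).obj b))
        ((isAlgHom_algebraComparison F a).comp hu)
        ((isAlgHom_map F u.hom).comp (isAlgHom_algebraComparison F b))
        ((Category.id_comp _).trans (Category.comp_id _).symm) (by
          have ha : (F a.A).l ≫ a.a.left = 𝟙 _ := congrArg VertArrow.Hom.left a.unit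
          have hb : (F b.A).l ≫ b.a.left = 𝟙 _ := congrArg VertArrow.Hom.left b.unit
          refine (Category.assoc _ _ _).symm.trans ((congrArg (· ≫ u.hom.left) ha).trans ?_)
          refine Eq.trans ?_ ((congrArg (· ≫ b.a.left) (l_map F u.hom).symm).trans
            (Category.assoc _ _ _))
          refine Eq.trans ?_ (Category.assoc _ _ _).symm
          refine (Category.id_comp _).trans ((Category.comp_id _).symm.trans ?_)
          exact congrArg (u.hom.left ≫ ·) hb.symm)
    have ha : a.a.right = 𝟙 _ :=
      (Category.id_comp _).symm.trans (congrArg VertArrow.Hom.right a.unit)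
    have hb : b.a.right = 𝟙 _ :=
      (Category.id_comp _).symm.trans (congrArg VertArrow.Hom.right b.unit)
    refine ⟨⟨u.hom, VertArrow.hom_ext h₁.symm ?_⟩, rfl⟩
    refine (congrArg (u.hom.right ≫ ·) hb).trans ((Category.comp_id _).trans ?_)
    exact ((congrArg (· ≫ u.hom.right) ha).trans (Category.id_comp _)).symm⟩
  bijective_obj := by
    refine Function.bijective_iff_has_inverse.2 ⟨fun a => toAlgebra F (ofRAlg a), ?_, ?_⟩
    · exact toAlgebra_algebraComparison F
    · exact algebraComparison_toAlgebra F

theorem isAlgebraicallyFreeOn (c : W.Comult) : (awfs F c).IsAlgebraicallyFreeOn ⟨W, c⟩ :=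
  ⟨lawfsHom F c, inferInstanceAs (algebraComparison F).IsIso⟩

end FreeAwfs

/-! ### From fibrewise free algebras to free algebras -/

theorem cod_isHomLift_id_iff {X X' Y : E} {g : X ⟶ Y} {h : X' ⟶ Y} {hg : IsVertical p g}
    {hh : IsVertical p h} (u : (⟨X, Y, g, hg⟩ : VertArrow p) ⟶ ⟨X', Y, h, hh⟩) :
    (cod p).IsHomLift (𝟙 Y) u ↔ u.right = 𝟙 Y := by
  constructor
  · intro hu
    exact (IsHomLift.eq_of_isHomLift (cod p) (a := ⟨X, Y, g, hg⟩) (b := ⟨X', Y, h, hh⟩)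
      (𝟙 Y) u).symm
  · intro hu
    rw [← hu]
    exact Functor.IsHomLift.map (p := cod p) u

/-- A vertical map as an object of the slice over its codomain. -/
abbrev VertArrow.slice (f : VertArrow p) : (cod p).Fiber f.right := ⟨f, rfl⟩

/-- A morphism of the slice over `Y`. -/
abbrev fiberHom {X X' Y : E} {g : X ⟶ Y} {h : X' ⟶ Y} (hg : IsVertical p g)
    (hh : IsVertical p h) (k : X ⟶ X') (w : k ≫ h = g) :
    VertArrow.slice ⟨X, Y, g, hg⟩ ⟶ VertArrow.slice ⟨X', Y, h, hh⟩ :=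
  ⟨⟨k, 𝟙 Y, w.trans (Category.comp_id g).symm⟩, (cod_isHomLift_id_iff _).2 rfl⟩

namespace FunctorialFactorisation

variable {W : FunctorialFactorisation p} {f : VertArrow p}

/-- An algebra on a vertical map with the codomain of `f` which is free on `f` among such
algebras. -/
structure FiberFree (W : FunctorialFactorisation p) (f : VertArrow p) where
  K : E
  l : f.left ⟶ K
  r : K ⟶ f.right
  vertical_r : IsVertical p r
  fac : l ≫ r = f.hom
  str : W.Str ⟨K, f.right, r, vertical_r⟩
  univ : ∀ {X : E} {h : X ⟶ f.right} {hh : IsVertical p h} (b : W.Str ⟨X, f.right, h, hh⟩)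
    (x : f.left ⟶ X), x ≫ h = f.hom → ∃! k : K ⟶ X, l ≫ k = x ∧ IsAlgHom str b k (𝟙 f.right)

/-- Algebras can be reindexed along arbitrary maps. -/
theorem exists_cart_str [(cod p).IsFibered] {g : VertArrow p} (b : W.Str g) {Y : E}
    (y : Y ⟶ g.right) : ∃ (X : E) (h : X ⟶ Y) (hh : IsVertical p h) (b' : W.Str ⟨X, Y, h, hh⟩)
      (q : X ⟶ g.left), IsAlgHom b' b q y ∧
      (∀ {e : VertArrow p} (x : e.left ⟶ g.left) (z : e.right ⟶ Y),
        x ≫ g.hom = e.hom ≫ z ≫ y → ∃! x' : e.left ⟶ X, x' ≫ h = e.hom ≫ z ∧ x' ≫ q = x) ∧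
      ∀ {e : VertArrow p} (a : W.Str e) (x' : e.left ⟶ X) (z : e.right ⟶ Y),
        x' ≫ h = e.hom ≫ z → IsAlgHom a b (x' ≫ q) (z ≫ y) → IsAlgHom a b' x' z := by
  obtain ⟨⟨X, Y', h, hh⟩, φ, hφ⟩ := exists_cart (cod p) (X := g) rfl y
  have hY : Y' = Y := lift_dom hφ.toIsHomLift
  subst hY
  have hy : φ.right = y :=
    (IsHomLift.eq_of_isHomLift (cod p) (a := ⟨X, Y', h, hh⟩) (b := g) y φ).symm
  subst hy
  have hw : φ.left ≫ g.hom = h ≫ φ.right := φ.w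
  have lift : ∀ {e : VertArrow p} (x : e.left ⟶ g.left) (z : e.right ⟶ Y'),
      x ≫ g.hom = e.hom ≫ z ≫ φ.right →
      ∃ x' : e.left ⟶ X, x' ≫ h = e.hom ≫ z ∧ x' ≫ φ.left = x := by
    intro e x z hx
    obtain ⟨k, hk, ek⟩ := cart_lift hφ (⟨x, z ≫ φ.right, hx⟩ : e ⟶ g) z
      (Functor.IsHomLift.map (p := cod p) (⟨x, z ≫ φ.right, hx⟩ : e ⟶ g))
    have hz : k.right = z :=
      (IsHomLift.eq_of_isHomLift (cod p) (a := e) (b := ⟨X, Y', h, hh⟩) z k).symm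
    exact ⟨k.left, k.w.trans (congrArg (e.hom ≫ ·) hz), congrArg VertArrow.Hom.left ek⟩
  have ext : ∀ {e : VertArrow p} {x x' : e.left ⟶ X} (z : e.right ⟶ Y'), x ≫ h = e.hom ≫ z →
      x' ≫ h = e.hom ≫ z → x ≫ φ.left = x' ≫ φ.left → x = x' := by
    intro e x x' z hx hx' hxx
    have := cart_ext hφ (a := (⟨x, z, hx⟩ : e ⟶ ⟨X, Y', h, hh⟩)) (b := ⟨x', z, hx'⟩) z
      (Functor.IsHomLift.map (p := cod p) (⟨x, z, hx⟩ : e ⟶ ⟨X, Y', h, hh⟩))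
      (Functor.IsHomLift.map (p := cod p) (⟨x', z, hx'⟩ : e ⟶ ⟨X, Y', h, hh⟩))
      (VertArrow.hom_ext hxx rfl)
    exact congrArg VertArrow.Hom.left this
  -- The reindexed structure is the factorisation of `K h ⟶ K g ⟶ g.left` through the cartesian map.
  -- Its unit law, and the reflection of algebra morphisms along that map, follow from uniqueness of
  -- such factorisations.
  obtain ⟨s, hs, sq⟩ := lift (e := ⟨W.K.obj ⟨X, Y', h, hh⟩, Y', W.r.app _, W.vertical_r _⟩)
    (W.sq (f := ⟨X, Y', h, hh⟩) (g := g) φ.left φ.right hw ≫ b.s) (𝟙 Y') (by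
      rw [Category.assoc, b.s_hom, sq_r, Category.id_comp])
  have hs' : s ≫ h = W.r.app ⟨X, Y', h, hh⟩ := hs.trans (Category.comp_id _)
  refine ⟨X, h, hh, ⟨s, ?_, hs'⟩, φ.left, ⟨hw, sq.symm⟩, ?_, ?_⟩
  · refine ext (e := ⟨X, Y', h, hh⟩) (𝟙 _) ?_ ?_ ?_
    · rw [Category.assoc, hs', W.fac, Category.comp_id]
    · exact (Category.id_comp _).trans (Category.comp_id _).symm
    · rw [Category.assoc, sq, ← Category.assoc, l_sq, Category.assoc, b.l_s]
      exact (Category.comp_id _).trans (Category.id_comp _).symm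
  · intro e x z hx
    obtain ⟨x', h₁, h₂⟩ := lift x z hx
    exact ⟨x', ⟨h₁, h₂⟩, fun k hk => ext z hk.1 h₁ (hk.2.trans h₂.symm)⟩
  · intro e a x' z h₁ hm
    refine ⟨h₁, ?_⟩
    have hm' := hm.comm
    have he := a.s_hom
    refine ext (e := W.R.obj e) z ?_ ?_ ?_
    · change (W.sq (f := e) (g := ⟨X, Y', h, hh⟩) x' z h₁ ≫ s) ≫ h = W.r.app e ≫ z
      rw [Category.assoc, hs', sq_r]
    · rw [Category.assoc, h₁, ← Category.assoc, he]
    · change (W.sq (f := e) (g := ⟨X, Y', h, hh⟩) x' z h₁ ≫ s) ≫ φ.left = _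
      rw [Category.assoc, sq, Category.assoc, ← hm', sq_comp_assoc]

/-- An algebra which is free in its fibre is free. -/
def FiberFree.toFree [(cod p).IsFibered] (F : W.FiberFree f) : W.Free f where
  __ := F
  univ {g} b x y w := by
    -- Reindexing `b` along `y` moves the problem into the fibre over `f.right`; composing with `q`
    -- moves the solution back.
    obtain ⟨X, h, hh, b', q, hq, lift, alg⟩ := exists_cart_str b y
    obtain ⟨x', ⟨hx', xq⟩, ux⟩ := lift (e := f) x (𝟙 _) (by rw [w, Category.id_comp])
    obtain ⟨k, ⟨hk, mk⟩, uk⟩ := F.univ b' x' (hx'.trans (Category.comp_id _))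
    refine ⟨k ≫ q, ⟨by rw [← Category.assoc, hk, xq], ?_⟩, ?_⟩
    · have := mk.comp hq
      exact Category.id_comp y ▸ this
    · rintro t ⟨ht, mt⟩
      obtain ⟨t', ⟨ht', tq⟩, -⟩ := lift (e := ⟨F.K, f.right, F.r, F.vertical_r⟩) t (𝟙 _)
        (mt.w.trans (congrArg (F.r ≫ ·) (Category.id_comp y).symm))
      have ht'' : t' ≫ h = F.r := ht'.trans (Category.comp_id _)
      -- For uniqueness, a competitor `t` factors through `q`, and `alg` shows that the factor is
      -- again an algebra morphism, now within the fibre.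
      have e : t' = k := uk t' ⟨ux _ ⟨by
          rw [Category.assoc, ht'', F.fac, Category.comp_id], by rw [Category.assoc, tq, ht]⟩,
        alg F.str t' (𝟙 _) ht' (by rw [tq]; exact (Category.id_comp y).symm ▸ mt)⟩
      rw [← tq, e]

/-- An algebra as an object of the fibre over the codomain of its underlying vertical map. -/
abbrev Str.fiber {X Y : E} {h : X ⟶ Y} {hh : IsVertical p h} (b : W.Str ⟨X, Y, h, hh⟩) :
    (W.U ⋙ cod p).Fiber Y := ⟨b.toRAlg, rfl⟩

theorem Str.right_eq_id {X X' Y : E} {h : X ⟶ Y} {hh : IsVertical p h} {h' : X' ⟶ Y}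
    {hh' : IsVertical p h'} {b : W.Str ⟨X, Y, h, hh⟩} {b' : W.Str ⟨X', Y, h', hh'⟩}
    (φ : b.fiber ⟶ b'.fiber) : φ.1.hom.right = 𝟙 Y :=
  (cod_isHomLift_id_iff φ.1.hom).1 ((W.UFiber Y).map φ).2

theorem Str.isAlgHom_of_hom {X X' Y : E} {h : X ⟶ Y} {hh : IsVertical p h} {h' : X' ⟶ Y}
    {hh' : IsVertical p h'} {b : W.Str ⟨X, Y, h, hh⟩} {b' : W.Str ⟨X', Y, h', hh'⟩}
    (φ : b.fiber ⟶ b'.fiber) : IsAlgHom b b' φ.1.hom.left (𝟙 Y) :=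
  (FunctorialFactorisation.isAlgHom_of_hom φ.1).congr_right (right_eq_id φ)

/-- A morphism of algebras in a fibre. -/
def Str.fiberAlgHom {X X' Y : E} {h : X ⟶ Y} {hh : IsVertical p h} {h' : X' ⟶ Y}
    {hh' : IsVertical p h'} {b : W.Str ⟨X, Y, h, hh⟩} {b' : W.Str ⟨X', Y, h', hh'⟩} {k : X ⟶ X'}
    (m : IsAlgHom b b' k (𝟙 Y)) : b.fiber ⟶ b'.fiber :=
  ⟨IsAlgHom.toHom (a := b.toRAlg) (b := b'.toRAlg) m,
    Functor.IsHomLift.map (p := W.U ⋙ cod p) (IsAlgHom.toHom (a := b.toRAlg) (b := b'.toRAlg) m)⟩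

/-- An algebra together with a map from `f`, over the codomain of `f`. -/
abbrev sliceArrow {X : E} {h : X ⟶ f.right} {hh : IsVertical p h} (b : W.Str ⟨X, f.right, h, hh⟩)
    (x : f.left ⟶ X) (w : x ≫ h = f.hom) : StructuredArrow f.slice (W.UFiber f.right) :=
  StructuredArrow.mk (Y := b.fiber) (fiberHom f.vertical hh x w)

/-- A strict equality is available because membership in the fibre and the unit law force the
codomain components to be identities. Initiality can thus be tested on objects in this normal form.
-/
theorem exists_eq_sliceArrow (I : StructuredArrow f.slice (W.UFiber f.right)) :
    ∃ (X : E) (h : X ⟶ f.right) (hh : IsVertical p h) (b : W.Str ⟨X, f.right, h, hh⟩)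
      (x : f.left ⟶ X) (w : x ≫ h = f.hom), I = sliceArrow b x w := by
  obtain ⟨⟨⟨⟩⟩, ⟨⟨⟨K, Y, r, hr⟩, s, hs⟩, hY⟩, η, hη⟩ := I
  change Y = f.right at hY
  subst hY
  change f ⟶ ⟨K, f.right, r, hr⟩ at η
  have hη' : η.right = 𝟙 f.right := (cod_isHomLift_id_iff (g := f.hom) (hg := f.vertical) η).1 hη
  have hs' := RAlg_str_right ⟨_, s, hs⟩
  obtain ⟨s₁, s₂, sw⟩ := s
  obtain ⟨η₁, η₂, ηw⟩ := η
  dsimp only at hη' hs'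
  subst hη' hs'
  exact ⟨K, r, hr, ofRAlg ⟨_, _, hs⟩, η₁, ηw.trans (Category.comp_id _), rfl⟩

theorem FiberFree.nonempty_of_hasInitial_structuredArrow
    [HasInitial (StructuredArrow f.slice (W.UFiber f.right))] : Nonempty (W.FiberFree f) := by
  obtain ⟨I, ⟨hI⟩⟩ : ∃ I : StructuredArrow f.slice (W.UFiber f.right), Nonempty (IsInitial I) :=
    ⟨_, ⟨initialIsInitial⟩⟩
  obtain ⟨K, r, hr, a, l, fac, rfl⟩ := exists_eq_sliceArrow I
  refine ⟨⟨K, l, r, hr, fac, a, ?_⟩⟩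
  intro X h hh b x hx
  let φ := hI.to (sliceArrow b x hx)
  refine ⟨φ.right.1.hom.left, ⟨?_, Str.isAlgHom_of_hom φ.right⟩, ?_⟩
  · exact congrArg (fun t => VertArrow.Hom.left t.1) (StructuredArrow.w φ)
  · rintro k ⟨hk, mk⟩
    have := hI.hom_ext (StructuredArrow.homMk (f := sliceArrow a l fac)
      (f' := sliceArrow b x hx) (Str.fiberAlgHom mk) (Subtype.ext
      (VertArrow.hom_ext hk (Category.comp_id _)))) φ
    exact congrArg (fun t : sliceArrow a l fac ⟶ sliceArrow b x hx => t.right.1.hom.left) this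

/-! ### Initial algebras for the coproduct endofunctor -/

section Slice

variable {Y : E} [HasBinaryCoproducts ((cod p).Fiber Y)] (f : (cod p).Fiber Y)

/-- The first coproduct inclusion. -/
def sliceInl (g : (cod p).Fiber Y) : f ⟶ (W.sliceEndo f).obj g := coprod.inl

/-- The second coproduct inclusion. -/
def sliceInr (g : (cod p).Fiber Y) : (W.RFiber Y).obj g ⟶ (W.sliceEndo f).obj g := coprod.inr

/-- The copairing. -/
def sliceDesc {g k : (cod p).Fiber Y} (x : f ⟶ k) (t : (W.RFiber Y).obj g ⟶ k) :
    (W.sliceEndo f).obj g ⟶ k := coprod.desc x t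

variable {f} {g k : (cod p).Fiber Y}

theorem sliceInl_desc (x : f ⟶ k) (t : (W.RFiber Y).obj g ⟶ k) :
    W.sliceInl f g ≫ W.sliceDesc f x t = x := coprod.inl_desc x t

theorem sliceInr_desc (x : f ⟶ k) (t : (W.RFiber Y).obj g ⟶ k) :
    W.sliceInr f g ≫ W.sliceDesc f x t = t := coprod.inr_desc x t

theorem slice_hom_ext {a b : (W.sliceEndo f).obj g ⟶ k}
    (h₁ : W.sliceInl f g ≫ a = W.sliceInl f g ≫ b)
    (h₂ : W.sliceInr f g ≫ a = W.sliceInr f g ≫ b) : a = b := coprod.hom_ext h₁ h₂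

theorem sliceInl_map (u : g ⟶ k) : W.sliceInl f g ≫ (W.sliceEndo f).map u = W.sliceInl f k :=
  (coprod.inl_map (𝟙 f) ((W.RFiber Y).map u)).trans (Category.id_comp _)

theorem sliceInr_map (u : g ⟶ k) :
    W.sliceInr f g ≫ (W.sliceEndo f).map u = (W.RFiber Y).map u ≫ W.sliceInr f k :=
  coprod.inr_map (𝟙 f) ((W.RFiber Y).map u)

theorem slicePoint_app : (W.slicePoint f).app g = (W.pointFiber Y).app g ≫ W.sliceInr f g := rfl

end Slice

section

variable [HasBinaryCoproducts ((cod p).Fiber f.right)]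

/-- The structure map of an algebra as a morphism of the slice. -/
abbrev Str.fiberStr {X Y : E} {h : X ⟶ Y} {hh : IsVertical p h} (b : W.Str ⟨X, Y, h, hh⟩) :
    (W.RFiber Y).obj (VertArrow.slice ⟨X, Y, h, hh⟩) ⟶ VertArrow.slice ⟨X, Y, h, hh⟩ :=
  fiberHom (W.vertical_r ⟨X, Y, h, hh⟩) hh b.s b.s_hom

/-- An algebra together with a map from `f`, as an algebra over `sliceEndo`. -/
abbrev sliceAlg {X : E} {h : X ⟶ f.right} {hh : IsVertical p h} (b : W.Str ⟨X, f.right, h, hh⟩)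
    (x : f.left ⟶ X) (w : x ≫ h = f.hom) :
    PointedAlgebra (W.sliceEndo f.slice) (W.slicePoint f.slice) where
  carrier := VertArrow.slice ⟨X, f.right, h, hh⟩
  str := sliceDesc f.slice (fiberHom f.vertical hh x w) b.fiberStr
  unit := by
    rw [slicePoint_app, Category.assoc, sliceInr_desc]
    exact Subtype.ext (VertArrow.hom_ext b.l_s (Category.comp_id _))

/-- The two coproduct inclusions split the structure map into a map from `f` and a map from `R`; the
unit law concerns only the latter, which is therefore an `R`-algebra structure. -/
theorem exists_eq_sliceAlg (I : PointedAlgebra (W.sliceEndo f.slice) (W.slicePoint f.slice)) :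
    ∃ (X : E) (h : X ⟶ f.right) (hh : IsVertical p h) (b : W.Str ⟨X, f.right, h, hh⟩)
      (x : f.left ⟶ X) (w : x ≫ h = f.hom), I = sliceAlg b x w := by
  obtain ⟨⟨⟨K, Y, r, hr⟩, hY⟩, s, hs⟩ := I
  change Y = f.right at hY
  subst hY
  change (W.sliceEndo f.slice).obj (VertArrow.slice ⟨K, f.right, r, hr⟩) ⟶
    VertArrow.slice ⟨K, f.right, r, hr⟩ at s
  let x := W.sliceInl f.slice _ ≫ s
  let t := W.sliceInr f.slice _ ≫ s
  have hx : x.1.right = 𝟙 _ := (cod_isHomLift_id_iff (hg := f.vertical) x.1).1 x.2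
  have ht : t.1.right = 𝟙 _ := (cod_isHomLift_id_iff (hg := W.vertical_r _) t.1).1 t.2
  have hu : (W.pointFiber f.right).app _ ≫ t = 𝟙 _ := (Category.assoc _ _ _).symm.trans hs
  have hu' := congrArg (fun q => q.1.left) hu
  let b : W.Str ⟨K, f.right, r, hr⟩ := ⟨t.1.left, hu', t.1.w.trans
    ((congrArg (W.r.app _ ≫ ·) ht).trans (Category.comp_id _))⟩
  have hw : x.1.left ≫ r = f.hom :=
    x.1.w.trans ((congrArg (f.hom ≫ ·) hx).trans (Category.comp_id _))
  refine ⟨K, r, hr, b, x.1.left, hw, ?_⟩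
  have e : s = (sliceAlg b x.1.left hw).str := by
    refine slice_hom_ext ?_ ?_
    · rw [sliceInl_desc]
      exact Subtype.ext (VertArrow.hom_ext rfl hx)
    · rw [sliceInr_desc]
      exact Subtype.ext (VertArrow.hom_ext rfl ht)
  exact PointedAlgebra.mk_eq (X := sliceAlg b x.1.left hw) hs e

/-- Restriction of the morphism equation to the first summand gives compatibility with the maps from
`f`, and to the second the algebra morphism condition. -/
theorem sliceAlg_hom {X X' : E} {h : X ⟶ f.right} {hh : IsVertical p h} {h' : X' ⟶ f.right}
    {hh' : IsVertical p h'} {b : W.Str ⟨X, f.right, h, hh⟩} {b' : W.Str ⟨X', f.right, h', hh'⟩}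
    {x : f.left ⟶ X} {w : x ≫ h = f.hom} {x' : f.left ⟶ X'} {w' : x' ≫ h' = f.hom}
    (φ : sliceAlg b x w ⟶ sliceAlg b' x' w') :
    x ≫ φ.hom.1.left = x' ∧ IsAlgHom b b' φ.hom.1.left (𝟙 _) := by
  have hr : φ.hom.1.right = 𝟙 _ := (cod_isHomLift_id_iff φ.hom.1).1 φ.hom.2
  have h₁ := congrArg (W.sliceInl f.slice _ ≫ ·) φ.comm
  have h₂ := congrArg (W.sliceInr f.slice _ ≫ ·) φ.comm
  dsimp only at h₁ h₂
  rw [← Category.assoc, sliceInl_map, sliceInl_desc, ← Category.assoc, sliceInl_desc] at h₁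
  rw [← Category.assoc, sliceInr_map, Category.assoc, sliceInr_desc, ← Category.assoc,
    sliceInr_desc] at h₂
  exact ⟨(congrArg (fun q => q.1.left) h₁).symm,
    IsAlgHom.congr_right ⟨φ.hom.1.w, congrArg (fun q => q.1.left) h₂⟩ hr⟩

/-- A morphism of algebras over `sliceEndo`. -/
def sliceAlgHom {X X' : E} {h : X ⟶ f.right} {hh : IsVertical p h} {h' : X' ⟶ f.right}
    {hh' : IsVertical p h'} {b : W.Str ⟨X, f.right, h, hh⟩} {b' : W.Str ⟨X', f.right, h', hh'⟩}
    {x : f.left ⟶ X} {w : x ≫ h = f.hom} {x' : f.left ⟶ X'} {w' : x' ≫ h' = f.hom} {k : X ⟶ X'}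
    (hk : x ≫ k = x') (m : IsAlgHom b b' k (𝟙 _)) : sliceAlg b x w ⟶ sliceAlg b' x' w' where
  hom := fiberHom hh hh' k (m.w.trans (Category.comp_id _))
  comm := by
    refine slice_hom_ext ?_ ?_
    · rw [← Category.assoc, sliceInl_map, sliceInl_desc, ← Category.assoc, sliceInl_desc]
      exact Subtype.ext (VertArrow.hom_ext hk.symm (Category.comp_id _).symm)
    · rw [← Category.assoc, sliceInr_map, Category.assoc, sliceInr_desc, ← Category.assoc,
        sliceInr_desc]
      exact Subtype.ext (VertArrow.hom_ext m.comm rfl)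

theorem FiberFree.nonempty_of_hasInitial_pointedAlgebra
    [HasInitial (PointedAlgebra (W.sliceEndo f.slice) (W.slicePoint f.slice))] :
    Nonempty (W.FiberFree f) := by
  obtain ⟨I, ⟨hI⟩⟩ : ∃ I : PointedAlgebra (W.sliceEndo f.slice) (W.slicePoint f.slice),
    Nonempty (IsInitial I) := ⟨_, ⟨initialIsInitial⟩⟩
  obtain ⟨K, r, hr, a, l, fac, rfl⟩ := exists_eq_sliceAlg I
  refine ⟨⟨K, l, r, hr, fac, a, ?_⟩⟩
  intro X h hh b x hx
  refine ⟨_, sliceAlg_hom (hI.to (sliceAlg b x hx)), ?_⟩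
  rintro k ⟨hk, mk⟩
  have := hI.hom_ext (sliceAlgHom hk mk) (hI.to (sliceAlg b x hx))
  exact congrArg (fun t : sliceAlg a l fac ⟶ sliceAlg b x hx => t.hom.1.left) this

end

/-- Both parts of the theorem end here: each initiality hypothesis serves to supply fibrewise free
algebras, one of which is chosen for every `f`. -/
theorem exists_awfs_of_fiberFree [(cod p).IsFibered] (c : W.Comult)
    (h : ∀ f, Nonempty (W.FiberFree f)) : ∃ A : Awfs p, A.IsAlgebraicallyFreeOn ⟨W, c⟩ :=
  ⟨FreeAwfs.awfs (fun f => (h f).some.toFree) c, FreeAwfs.isAlgebraicallyFreeOn _ c⟩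

end FunctorialFactorisation

end

end FibredAwfs

theorem mainTheorem5
    {B : Type u₁} [Category.{v₁} B] {E : Type u₂} [Category.{v₂} E]
    (p : E ⥤ B) [p.IsFibered] [(cod p).IsFibered] :
    -- over a fibration, for an arbitrary lawfs
    (∀ W : Lawfs p,
      (∀ (Y : E) (f : (cod p).Fiber Y), HasInitial (StructuredArrow f (W.fact.UFiber Y))) →
      ∃ A : Awfs p, A.IsAlgebraicallyFreeOn W) ∧
    -- over a locally small bifibration, for step-one of a vertical map
    (∀ [HasFiniteLimits B] [LocallySmall p] [IsOpfibration p] [IsOpfibration (dom p)]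
      [∀ Y : E, HasBinaryCoproducts ((cod p).Fiber Y)] (m : VertArrow p),
      (∀ (Y : E) (f : (cod p).Fiber Y),
        HasInitial (PointedAlgebra ((stepOne p m).fact.sliceEndo f)
          ((stepOne p m).fact.slicePoint f))) →
      ∃ A : Awfs p, A.IsCofibrantlyGeneratedBy m) :=
  ⟨fun W h => FunctorialFactorisation.exists_awfs_of_fiberFree W.comult fun f =>
      have := h f.right ⟨f, rfl⟩
      FunctorialFactorisation.FiberFree.nonempty_of_hasInitial_structuredArrow,
    fun m h => FunctorialFactorisation.exists_awfs_of_fiberFree (stepOne p m).comult fun f =>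
      have := h f.right ⟨f, rfl⟩
      FunctorialFactorisation.FiberFree.nonempty_of_hasInitial_pointedAlgebra⟩
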